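/- Let $d\ge 1$, let $I_\pm=\{\pm1,\dots,\pm d\}$ and let $\{|\tau\rangle\}_{\tau\in I_\pm}$ be the canonical basis of $\mathbb C^{2d}$. Let $r:I_\pm\to\mathbb Z^d$ be an arbitrary jump function, with mean $\overline r=\frac1{2d}\sum_{\tau\in I_\pm} r(\tau)$. On $\mathbb C^{2d}\otimes \ell^2(\mathbb Z^d)$ let $S$ be the shift $S\,|\tau\rangle\otimes|x\rangle=|\tau\rangle\otimes|x+r(\tau)\rangle$. Let $C(\omega)$ be a random unitary $2d\times 2d$ matrix on a probability space $(\Omega,\mu)$ and let $\overline\omega=(\omega_1,\omega_2,\dots)$ be distributed according to $\mathbb P=\mu^{\otimes\mathbb N^*}$. Put $U_{\overline\omega}(n,0)=U_n\cdots U_1$ with $U_s=S\,(C(\omega_s)\otimes\mathbb I)$. For a unit vector $\varphi_0\in\mathbb C^{2d}$ and $\psi_0=\varphi_0\otimes|0\rangle$, let $W^{\overline\omega}_k(n)=\|(U_{\overline\omega}(n,0)\psi_0)(k)\|^2_{\mathbb C^{2d}}$ for $k\in\mathbb Z^d$, let $w_k(n)=\mathbb E\,(W^{\overline\omega}_k(n))$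 be the averaged distribution, and let $X_n$ be a $\mathbb Z^d$-valued random vector with law $w(n)$. Let $\mathcal E=\mathbb E(C(\omega)\otimes\overline{C(\omega)})$ on $\mathbb C^{2d}\otimes\mathbb C^{2d}$, let $D(y,y')$ be the diagonal matrix with $D(y,y')\,|\tau\otimes\tau'\rangle=e^{i(y\cdot r(\tau)+y'\cdot r(\tau'))}|\tau\otimes\tau'\rangle$, and let $\mathcal M(y,y')=D(y,y')\,\mathcal E$ for $y,y'\in\mathbb R^d$. Assumption S: for every $v\in\mathbb T^d=(\mathbb R/2\pi\mathbb Z)^d$, the only point of the spectrum of $\mathcal M(-v,v)$ on the unit circle is $1$, and $1$ is a simple eigenvalue of $\mathcal M(-v,v)$. Let $P=|\Psi_0\rangle\langle\Psi_0|$ with $\Psi_0=\frac1{\sqrt{2d}}\sum_{\tau\in I_\pm}|\tau\otimes\tau\rangle$. Let $S_v(1)$ be the value at $z=1$ of the reduced resolvent $S_v(z)$ of $\mathcal M(-v,v)$, which is defined near $z=1$ by $(\mathcal M(-v,v)-z)^{-1}=\frac{P}{1-z}+S_v(z)$. For $v\in\mathbb T^d$ the diffusion matrix $\mathbb D(v)$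 is the $d\times d$ matrix with entries $$\mathbb D_{ij}(v)=\overline r_i\,\overline r_j-\frac1{2d}\sum_{\tau\in I_\pm} r_i(\tau)r_j(\tau)-\frac1{2d}\sum_{\tau,\tau'\in I_\pm}\bigl(r_i(\tau)r_j(\tau')+r_j(\tau)r_i(\tau')\bigr)\langle\tau\otimes\tau|S_v(1)\,\tau'\otimes\tau'\rangle .$$ Equivalently, $\mathbb D(v)$ is the symmetric matrix for which the eigenvalue $\lambda_1(y,v)$ of $\mathcal M(y-v,v)$ close to $1$ satisfies $e^{-iy\cdot\overline r}\lambda_1(y,v)=1-\frac12\langle y|\mathbb D(v)y\rangle+O(\|y\|^3)$ as $y\to0$. Corollary. Suppose that Assumption S holds and that $\mathbb D(v)=\mathbb D$ does not depend on $v\in\mathbb T^d$, where $\mathbb D$ is a real positive definite matrix. Then, for every initial vector $\psi_0=\varphi_0\otimes|0\rangle$ with $\|\varphi_0\|=1$, as $n\to\infty$, $$\frac{X_n-n\overline r}{\sqrt n}\longrightarrow \mathcal N(0,\mathbb D)\quad\text{in distribution.}$$ -/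

import Mathlib

open MeasureTheory ProbabilityTheory Filter Topology

open scoped Matrix Kronecker ENNReal

noncomputable section

namespace QuantumWalk

/-- The `2d` coin labels `I_± = {±1, …, ±d}`; the pair `(j, ε)` stands for `ε (j + 1)`. -/
abbrev Coin (d : ℕ) : Type := Fin d × ℤˣ

/-- The coin space `ℂ^{2d}`. -/
abbrev CoinSpace (d : ℕ) : Type := EuclideanSpace ℂ (Coin d)

/-- The Hilbert space of the walker, `ℂ^{2d} ⊗ ℓ²(ℤ^d)`, realised as `ℓ²(ℤ^d; ℂ^{2d})`. -/
abbrev WalkSpace (d : ℕ) : Type := lp (fun _ : Fin d → ℤ => CoinSpace d) 2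

variable {d : ℕ}

theorem memlp_coin (C : Matrix (Coin d) (Coin d) ℂ) (ψ : WalkSpace d) :
    Memℓp (fun x : Fin d → ℤ => (WithLp.toLp 2 (C *ᵥ (ψ x).ofLp) : CoinSpace d)) 2 := by
  have hψ := (lp.memℓp ψ).summable (by norm_num)
  refine memℓp_gen ?_
  simp only [ENNReal.toReal_ofNat, Real.rpow_ofNat] at hψ ⊢
  refine Summable.of_nonneg_of_le (fun x => by positivity) (fun x => ?_)
    (hψ.mul_left (‖Matrix.toEuclideanCLM (𝕜 := ℂ) C‖ ^ 2))
  rw [← mul_pow]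
  have h := (Matrix.toEuclideanCLM (𝕜 := ℂ) C).le_opNorm (ψ x)
  gcongr
  exact h

theorem memlp_shift (r : Coin d → Fin d → ℤ) (ψ : WalkSpace d) :
    Memℓp (fun x : Fin d → ℤ => (WithLp.toLp 2 fun τ => ψ (x - r τ) τ : CoinSpace d)) 2 := by
  have hψ := (lp.memℓp ψ).summable (by norm_num)
  refine memℓp_gen ?_
  simp only [ENNReal.toReal_ofNat, Real.rpow_ofNat, EuclideanSpace.norm_sq_eq] at hψ ⊢
  refine summable_sum fun τ _ => ?_
  have h1 : Summable fun x : Fin d → ℤ => ‖ψ x τ‖ ^ 2 :=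
    Summable.of_nonneg_of_le (fun x => by positivity)
      (fun x => Finset.single_le_sum (f := fun σ => ‖ψ x σ‖ ^ 2)
        (fun σ _ => by positivity) (Finset.mem_univ τ)) hψ
  exact h1.comp_injective (Equiv.subRight (r τ)).injective

/-- The coin update `C ⊗ 𝟙`. -/
def coinOp (C : Matrix (Coin d) (Coin d) ℂ) (ψ : WalkSpace d) : WalkSpace d :=
  ⟨fun x => WithLp.toLp 2 (C *ᵥ (ψ x).ofLp), memlp_coin C ψ⟩

/-- The shift `S (|τ⟩ ⊗ |y⟩) = |τ⟩ ⊗ |y + r(τ)⟩`, that is `(S ψ)(x)_τ = ψ(x - r(τ))_τ`. -/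
def shiftOp (r : Coin d → Fin d → ℤ) (ψ : WalkSpace d) : WalkSpace d :=
  ⟨fun x => WithLp.toLp 2 fun τ => ψ (x - r τ) τ, memlp_shift r ψ⟩

/-- The evolution `U_n ⋯ U_1` with `U_s = S (C_s ⊗ 𝟙)`; the `s`-th coin matrix is `c (s - 1)`. -/
def evolution (r : Coin d → Fin d → ℤ) (c : ℕ → Matrix (Coin d) (Coin d) ℂ) :
    ℕ → WalkSpace d → WalkSpace d
  | 0, ψ => ψ
  | n + 1, ψ => shiftOp r (coinOp (c n) (evolution r c n ψ))

/-- `W_k(n)`: the probability to find the walker at `k` at time `n`, when it starts in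
`φ₀ ⊗ |0⟩`. -/
def positionDist (r : Coin d → Fin d → ℤ) (c : ℕ → Matrix (Coin d) (Coin d) ℂ)
    (φ₀ : CoinSpace d) (n : ℕ) (k : Fin d → ℤ) : ℝ :=
  ‖evolution r c n (lp.single 2 0 φ₀) k‖ ^ 2

section Random

variable {Ω : Type*} [MeasurableSpace Ω]

/-- `w_k(n) = 𝔼 (W_k(n))`, for i.i.d. coin matrices `C(ω_1), C(ω_2), …` under `μ^{⊗ ℕ}`. -/
def averagedDist (μ : Measure Ω) [IsProbabilityMeasure μ] (C : Ω → Matrix (Coin d) (Coin d) ℂ)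
    (r : Coin d → Fin d → ℤ) (φ₀ : CoinSpace d) (n : ℕ) (k : Fin d → ℤ) : ℝ :=
  ∫ ω, positionDist r (fun s => C (ω s)) φ₀ n k ∂(Measure.infinitePi fun _ : ℕ => μ)

/-- The averaged distribution `w(n)` as a measure on `ℤ^d`. -/
def averagedLaw (μ : Measure Ω) [IsProbabilityMeasure μ] (C : Ω → Matrix (Coin d) (Coin d) ℂ)
    (r : Coin d → Fin d → ℤ) (φ₀ : CoinSpace d) (n : ℕ) : Measure (Fin d → ℤ) :=
  Measure.sum fun k => ENNReal.ofReal (averagedDist μ C r φ₀ n k) • Measure.dirac k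

/-- The drift `r̄ = (2d)⁻¹ ∑_τ r(τ)`. -/
def drift (r : Coin d → Fin d → ℤ) : EuclideanSpace ℝ (Fin d) :=
  WithLp.toLp 2 fun j => (2 * (d : ℝ))⁻¹ * ∑ τ, (r τ j : ℝ)

/-- The point `(k - n r̄) / √n`. -/
def rescale (r : Coin d → Fin d → ℤ) (n : ℕ) (k : Fin d → ℤ) : EuclideanSpace ℝ (Fin d) :=
  (√(n : ℝ))⁻¹ • (WithLp.toLp 2 (fun j => (k j : ℝ)) - (n : ℝ) • drift r)

/-- `ℰ = 𝔼 (C(ω) ⊗ C̄(ω))`, the expectation being taken entrywise. -/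
def meanTensor (μ : Measure Ω) (C : Ω → Matrix (Coin d) (Coin d) ℂ) :
    Matrix (Coin d × Coin d) (Coin d × Coin d) ℂ :=
  Matrix.of fun s t => ∫ ω, (C ω ⊗ₖ (C ω).map star) s t ∂μ

/-- The diagonal matrix `D(y, y')` with entries `exp (i (y ⬝ r(τ) + y' ⬝ r(τ')))`. -/
def phaseMatrix (r : Coin d → Fin d → ℤ) (y y' : Fin d → ℝ) :
    Matrix (Coin d × Coin d) (Coin d × Coin d) ℂ :=
  Matrix.diagonal fun t => Complex.exp (Complex.I *
    ((∑ j, y j * (r t.1 j : ℝ) + ∑ j, y' j * (r t.2 j : ℝ) : ℝ) : ℂ))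

/-- `ℳ(y, y') = D(y, y') ℰ`. -/
def meanM (μ : Measure Ω) (C : Ω → Matrix (Coin d) (Coin d) ℂ) (r : Coin d → Fin d → ℤ)
    (y y' : Fin d → ℝ) : Matrix (Coin d × Coin d) (Coin d × Coin d) ℂ :=
  phaseMatrix r y y' * meanTensor μ C

/-- For every `v`, `1` is the only eigenvalue of `ℳ(-v, v)` on the unit circle, and it is
(algebraically) simple. Quantifying over `v ∈ ℝ^d` is the same as over the torus, since
`ℳ(-v, v)` is `2π`-periodic in each coordinate of `v`. -/
def AssumptionS (μ : Measure Ω) (C : Ω → Matrix (Coin d) (Coin d) ℂ)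
    (r : Coin d → Fin d → ℤ) : Prop :=
  ∀ v : Fin d → ℝ,
    spectrum ℂ (meanM μ C r (-v) v) ∩ Metric.sphere (0 : ℂ) 1 = {1} ∧
      (meanM μ C r (-v) v).charpoly.rootMultiplicity 1 = 1

/-- `Ψ₁ = ∑_τ |τ ⊗ τ⟩`. -/
def psiOne (d : ℕ) : Coin d × Coin d → ℂ := fun t => if t.1 = t.2 then 1 else 0

/-- `P = |Ψ₀⟩⟨Ψ₀|` with `Ψ₀ = Ψ₁ / ‖Ψ₁‖`, where `‖Ψ₁‖² = 2d`. -/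
def projP (d : ℕ) : Matrix (Coin d × Coin d) (Coin d × Coin d) ℂ :=
  (2 * (d : ℂ))⁻¹ • Matrix.vecMulVec (psiOne d) (star (psiOne d))

/-- The value at `z = 1` of the reduced resolvent `S_v`, defined near `z = 1` by
`(ℳ(-v, v) - z)⁻¹ = P / (1 - z) + S_v(z)`. -/
def reducedResolvent (μ : Measure Ω) (C : Ω → Matrix (Coin d) (Coin d) ℂ)
    (r : Coin d → Fin d → ℤ) (v : Fin d → ℝ) :
    Matrix (Coin d × Coin d) (Coin d × Coin d) ℂ :=
  limUnder (𝓝[≠] (1 : ℂ)) fun z =>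
    (meanM μ C r (-v) v - z • (1 : Matrix (Coin d × Coin d) (Coin d × Coin d) ℂ))⁻¹
      - (1 - z)⁻¹ • projP d

/-- The diffusion matrix `𝔻(v)`. It is the symmetric matrix for which the eigenvalue
`λ₁(y, v)` of `ℳ(y - v, v)` close to `1` satisfies
`exp (-i y ⬝ r̄) λ₁(y, v) = 1 - ⟨y, 𝔻(v) y⟩ / 2 + O(‖y‖³)`. -/
def diffusionMatrix (μ : Measure Ω) (C : Ω → Matrix (Coin d) (Coin d) ℂ)
    (r : Coin d → Fin d → ℤ) (v : Fin d → ℝ) : Matrix (Fin d) (Fin d) ℂ :=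
  Matrix.of fun i j =>
    ((drift r i * drift r j : ℝ) : ℂ)
      - (2 * (d : ℂ))⁻¹ * ∑ τ, (r τ i : ℂ) * (r τ j : ℂ)
      - (2 * (d : ℂ))⁻¹ * ∑ τ, ∑ τ',
          ((r τ i : ℂ) * (r τ' j : ℂ) + (r τ j : ℂ) * (r τ' i : ℂ))
            * reducedResolvent μ C r v (τ, τ) (τ', τ')

end Random

end QuantumWalk

end

/-! In Fourier variables the walk acts fibre by fibre: one step multiplies the transformed state at
`ξ` by a unitary matrix. Take the tensor product of the transform at `θ - v` with the conjugate of
the transform at `-v`. Since the coins are independent, its mean evolves under the powers of `ℳ(θ -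
v, v)` (`integral_fourierTensor`). Tracing over the coin and averaging over `v` in the torus leaves
only pairs of equal sites, so the characteristic function of `w(n)` at `θ` is the torus integral of
`Ψ₁ ⬝ ℳ(θ - v, v)^n (φ₀ ⊗ φ̄₀)` (`sum_planeWave_mul_averagedDist`).

Put `θ = ε y` with `ε = 1/√n`. Removing the drift turns `ℳ(θ - v, v)` into `B_ε = exp(iεF) ℳ(-v,
v)`, where `F` is diagonal and holds the centred jumps along `y`. The perturbed eigenvalue is never
constructed. Second-order perturbation theory provides a vector `ℓ_ε = Ψ₁ + ε ℓ₁ + ε² ℓ₂` with `ℓ_ε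
B_ε = exp(-ε² q / 2) ℓ_ε + o(ε²)`. Unitarity of the coins bounds the orbit `B_ε^j (φ₀ ⊗ φ̄₀)`
uniformly, so `n` steps accumulate an error `n · o(1/n)` and the fibre converges to `exp(-q/2)`
(`tendsto_dotProduct_expDiagonal_pow`).

The reduced resolvent, which exists because the eigenvalue `1` is simple, solves for `ℓ₁` and `ℓ₂`
(`exists_perturbation_solution`). Solvability at first order is the centring of the jumps; at second
order it forces `q = ⟨y, 𝔻 y⟩`. The fibre limit does not depend on `v`, so dominated convergence on
the torus and Lévy's continuity theorem conclude. -/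

noncomputable section

namespace QuantumWalk

variable {d : ℕ}

/-! ### The walk for fixed coins, in position and Fourier space. -/

section Deterministic

/-- The component of the walker in the coin state `τ` at the site `k` at time `n`. -/
def amplitude (r : Coin d → Fin d → ℤ) (c : ℕ → Matrix (Coin d) (Coin d) ℂ) (φ₀ : CoinSpace d)
    (n : ℕ) (k : Fin d → ℤ) (τ : Coin d) : ℂ :=
  evolution r c n (lp.single 2 0 φ₀) k τ

/-- A finite set of sites that contains the support of the walker at time `n`. -/
def reach (r : Coin d → Fin d → ℤ) : ℕ → Finset (Fin d → ℤ)
  | 0 => {0}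
  | n + 1 => (reach r n ×ˢ Finset.univ).image fun p => p.1 + r p.2

/-- The plane wave `exp (i ξ ⬝ k)`. -/
def planeWave (ξ : Fin d → ℝ) (k : Fin d → ℤ) : ℂ :=
  Complex.exp (Complex.I * ((∑ j, ξ j * (k j : ℝ) : ℝ) : ℂ))

/-- The Fourier transform of the walker at time `n`. -/
def fourierAmplitude (r : Coin d → Fin d → ℤ) (c : ℕ → Matrix (Coin d) (Coin d) ℂ)
    (φ₀ : CoinSpace d) (n : ℕ) (ξ : Fin d → ℝ) (τ : Coin d) : ℂ :=
  ∑ k ∈ reach r n, planeWave ξ k * amplitude r c φ₀ n k τ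

variable (r : Coin d → Fin d → ℤ) (c : ℕ → Matrix (Coin d) (Coin d) ℂ) (φ₀ : CoinSpace d)

lemma positionDist_eq (n : ℕ) (k : Fin d → ℤ) :
    positionDist r c φ₀ n k = ∑ τ, ‖amplitude r c φ₀ n k τ‖ ^ 2 := by
  rw [positionDist, EuclideanSpace.norm_sq_eq]
  rfl

lemma amplitude_zero_self (τ : Coin d) : amplitude r c φ₀ 0 0 τ = φ₀ τ := by
  simp [amplitude, evolution]

lemma amplitude_zero_of_ne {k : Fin d → ℤ} (hk : k ≠ 0) (τ : Coin d) :
    amplitude r c φ₀ 0 k τ = 0 := by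
  simp [amplitude, evolution, Pi.single_eq_of_ne hk]

lemma amplitude_succ (n : ℕ) (k : Fin d → ℤ) (τ : Coin d) :
    amplitude r c φ₀ (n + 1) k τ = ∑ σ, c n τ σ * amplitude r c φ₀ n (k - r τ) σ := rfl

lemma add_mem_reach {n : ℕ} {k : Fin d → ℤ} (hk : k ∈ reach r n) (τ : Coin d) :
    k + r τ ∈ reach r (n + 1) :=
  Finset.mem_image.2 ⟨(k, τ), by simp [hk], rfl⟩

lemma amplitude_eq_zero {n : ℕ} {k : Fin d → ℤ} (hk : k ∉ reach r n) (τ : Coin d) :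
    amplitude r c φ₀ n k τ = 0 := by
  induction n generalizing k τ with
  | zero => exact amplitude_zero_of_ne r c φ₀ (by simpa [reach] using hk) τ
  | succ n ih =>
    rw [amplitude_succ]
    refine Finset.sum_eq_zero fun σ _ => ?_
    rw [ih (fun h => hk ?_), mul_zero]
    simpa using add_mem_reach r h τ

lemma planeWave_add (ξ : Fin d → ℝ) (k l : Fin d → ℤ) :
    planeWave ξ (k + l) = planeWave ξ k * planeWave ξ l := by
  simp only [planeWave, ← Complex.exp_add, ← mul_add, ← Complex.ofReal_add,
    ← Finset.sum_add_distrib, Pi.add_apply, Int.cast_add]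

lemma planeWave_add_left (ξ η : Fin d → ℝ) (k : Fin d → ℤ) :
    planeWave (ξ + η) k = planeWave ξ k * planeWave η k := by
  simp only [planeWave, ← Complex.exp_add, ← mul_add, ← Complex.ofReal_add,
    ← Finset.sum_add_distrib, Pi.add_apply, add_mul]

@[simp]
lemma planeWave_zero_right (ξ : Fin d → ℝ) : planeWave ξ 0 = 1 := by simp [planeWave]

@[simp]
lemma planeWave_zero_left (k : Fin d → ℤ) : planeWave 0 k = 1 := by simp [planeWave]

lemma star_planeWave (ξ : Fin d → ℝ) (k : Fin d → ℤ) :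
    star (planeWave ξ k) = planeWave (-ξ) k := by
  simp only [planeWave, Complex.star_def, ← Complex.exp_conj, map_mul, Complex.conj_I,
    Complex.conj_ofReal, Pi.neg_apply, neg_mul, Finset.sum_neg_distrib, Complex.ofReal_neg, mul_neg]

lemma norm_planeWave (ξ : Fin d → ℝ) (k : Fin d → ℤ) : ‖planeWave ξ k‖ = 1 := by
  rw [planeWave, mul_comm, Complex.norm_exp_ofReal_mul_I]

lemma continuous_planeWave (k : Fin d → ℤ) : Continuous fun ξ : Fin d → ℝ => planeWave ξ k := by
  unfold planeWave
  fun_prop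

lemma phaseMatrix_eq (y y' : Fin d → ℝ) :
    phaseMatrix r y y' = Matrix.diagonal fun t => planeWave y (r t.1) * planeWave y' (r t.2) := by
  simp only [phaseMatrix, planeWave, ← Complex.exp_add, ← mul_add, ← Complex.ofReal_add]

lemma fourierAmplitude_zero (ξ : Fin d → ℝ) (τ : Coin d) :
    fourierAmplitude r c φ₀ 0 ξ τ = φ₀ τ := by
  simp [fourierAmplitude, reach, amplitude_zero_self]

/-- Translation by `r τ` becomes multiplication by a phase, so different `ξ` decouple. -/
lemma fourierAmplitude_succ (n : ℕ) (ξ : Fin d → ℝ) (τ : Coin d) :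
    fourierAmplitude r c φ₀ (n + 1) ξ τ =
      planeWave ξ (r τ) * ∑ σ, c n τ σ * fourierAmplitude r c φ₀ n ξ σ := by
  have h : fourierAmplitude r c φ₀ (n + 1) ξ τ =
      ∑ k ∈ reach r n, planeWave ξ (k + r τ) * amplitude r c φ₀ (n + 1) (k + r τ) τ := by
    rw [← Finset.sum_image (f := fun k => planeWave ξ k * amplitude r c φ₀ (n + 1) k τ)
      (g := fun k => k + r τ) (fun a _ b _ hab => add_right_cancel hab)]
    -- Only part of `reach r (n + 1)` is reached through `τ`; at the other sites the `τ` component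
    -- vanishes.
    refine (Finset.sum_subset (fun k hk => ?_) fun k _ hk => ?_).symm
    · obtain ⟨l, hl, rfl⟩ := Finset.mem_image.1 hk
      exact add_mem_reach r hl τ
    · rw [amplitude_succ, Finset.sum_eq_zero, mul_zero]
      intro σ _
      rw [amplitude_eq_zero, mul_zero]
      exact fun h => hk (Finset.mem_image.2 ⟨k - r τ, h, by simp⟩)
  rw [h]
  simp only [amplitude_succ, add_sub_cancel_right, planeWave_add, fourierAmplitude, Finset.mul_sum]
  rw [Finset.sum_comm]
  refine Finset.sum_congr rfl fun σ _ => Finset.sum_congr rfl fun k _ => ?_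
  ring

lemma sum_norm_sq_mulVec {ι : Type*} [Fintype ι] [DecidableEq ι] {A : Matrix ι ι ℂ}
    (hA : A ∈ Matrix.unitaryGroup ι ℂ) (x : ι → ℂ) :
    ∑ i, ‖(A *ᵥ x) i‖ ^ 2 = ∑ i, ‖x i‖ ^ 2 := by
  have h (z : ι → ℂ) : ((∑ i, ‖z i‖ ^ 2 : ℝ) : ℂ) = star z ⬝ᵥ z := by
    simp [dotProduct, Complex.conj_mul']
  apply Complex.ofReal_injective
  rw [h, h, Matrix.star_mulVec, ← Matrix.dotProduct_mulVec, Matrix.mulVec_mulVec,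
    ← Matrix.star_eq_conjTranspose, Matrix.mem_unitaryGroup_iff'.1 hA, Matrix.one_mulVec]

variable {c} (hc : ∀ n, c n ∈ Matrix.unitaryGroup (Coin d) ℂ)

include hc

/-- Each fibre evolves unitarily; every bound uniform in `n` below comes from here. -/
lemma sum_norm_sq_fourierAmplitude (n : ℕ) (ξ : Fin d → ℝ) :
    ∑ τ, ‖fourierAmplitude r c φ₀ n ξ τ‖ ^ 2 = ‖φ₀‖ ^ 2 := by
  induction n with
  | zero => simp only [fourierAmplitude_zero, EuclideanSpace.norm_sq_eq]
  | succ n ih =>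
    simp only [fourierAmplitude_succ, norm_mul, norm_planeWave, one_mul]
    exact (sum_norm_sq_mulVec (hc n) _).trans ih

lemma norm_fourierAmplitude_le (n : ℕ) (ξ : Fin d → ℝ) (τ : Coin d) :
    ‖fourierAmplitude r c φ₀ n ξ τ‖ ≤ ‖φ₀‖ := by
  refine le_of_sq_le_sq ?_ (norm_nonneg _)
  rw [← sum_norm_sq_fourierAmplitude r φ₀ hc n ξ]
  exact Finset.single_le_sum (f := fun τ => ‖fourierAmplitude r c φ₀ n ξ τ‖ ^ 2)
    (fun _ _ => by positivity) (Finset.mem_univ τ)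

/-- A crude bound, growing with `n`, which serves only for integrability. -/
lemma norm_amplitude_le (n : ℕ) (k : Fin d → ℤ) (τ : Coin d) :
    ‖amplitude r c φ₀ n k τ‖ ≤ (Fintype.card (Coin d) : ℝ) ^ n * ‖φ₀‖ := by
  induction n generalizing k τ with
  | zero =>
    by_cases hk : k = 0
    · subst hk
      simpa [amplitude_zero_self] using PiLp.norm_apply_le φ₀ τ
    · simp [amplitude_zero_of_ne r c φ₀ hk]
  | succ n ih =>
    rw [amplitude_succ, pow_succ', mul_assoc, ← nsmul_eq_mul]
    refine norm_sum_le_of_le (f := fun σ => c n τ σ * amplitude r c φ₀ n (k - r τ) σ)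
      (n := fun _ => (Fintype.card (Coin d) : ℝ) ^ n * ‖φ₀‖) Finset.univ (fun σ _ => ?_) |>.trans ?_
    · rw [norm_mul]
      exact (mul_le_of_le_one_left (norm_nonneg _) (entry_norm_bound_of_unitary (hc n) τ σ)).trans
        (ih _ _)
    · simp

end Deterministic

/-! ### Averaging over independent coins. -/

section Expectation

variable {Ω : Type*} [MeasurableSpace Ω]

/-- The `σ`-algebra generated by the first `n` coins. -/
abbrev past (Ω : Type*) [MeasurableSpace Ω] (n : ℕ) : MeasurableSpace (ℕ → Ω) :=
  ⨆ i ∈ Set.Iio n, MeasurableSpace.comap (fun ω : ℕ → Ω => ω i) inferInstance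

lemma past_mono {m n : ℕ} (h : m ≤ n) : past Ω m ≤ past Ω n :=
  biSup_mono fun _ hi => lt_of_lt_of_le hi h

lemma past_le (n : ℕ) : past Ω n ≤ MeasurableSpace.pi :=
  iSup₂_le fun i _ => (measurable_pi_apply i).comap_le

lemma measurable_past_eval {m n : ℕ} (h : m < n) :
    Measurable[past Ω n] fun ω : ℕ → Ω => ω m :=
  (comap_measurable _).mono
    (le_iSup₂_of_le (f := fun i (_ : i ∈ Set.Iio n) =>
      MeasurableSpace.comap (fun ω : ℕ → Ω => ω i) inferInstance) m h le_rfl) le_rfl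

variable {C : Ω → Matrix (Coin d) (Coin d) ℂ} (hCmeas : ∀ σ τ, Measurable fun ω => C ω σ τ)
  (r : Coin d → Fin d → ℤ) (φ₀ : CoinSpace d)

include hCmeas

lemma measurable_past_amplitude (n : ℕ) (k : Fin d → ℤ) (τ : Coin d) :
    Measurable[past Ω n] fun ω : ℕ → Ω => amplitude r (fun s => C (ω s)) φ₀ n k τ := by
  induction n generalizing k τ with
  | zero =>
    have h : (fun ω : ℕ → Ω => amplitude r (fun s => C (ω s)) φ₀ 0 k τ) =
        fun _ => if k = 0 then φ₀ τ else 0 := by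
      funext ω
      split_ifs with hk
      · subst hk
        exact amplitude_zero_self ..
      · exact amplitude_zero_of_ne _ _ _ hk _
    rw [h]
    exact @measurable_const _ _ _ (past Ω 0) _
  | succ n ih =>
    simp only [amplitude_succ]
    refine @Finset.measurable_fun_sum _ _ _ _ _ _ (past Ω (n + 1)) _ _ fun σ _ => ?_
    exact Measurable.mul (m := past Ω (n + 1))
      ((hCmeas τ σ).comp (measurable_past_eval n.lt_succ_self))
      ((ih _ σ).mono (past_mono n.le_succ) le_rfl)

lemma measurable_amplitude (n : ℕ) (k : Fin d → ℤ) (τ : Coin d) :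
    Measurable fun ω : ℕ → Ω => amplitude r (fun s => C (ω s)) φ₀ n k τ :=
  (measurable_past_amplitude hCmeas r φ₀ n k τ).mono (past_le n) le_rfl

lemma measurable_past_fourierAmplitude (n : ℕ) (ξ : Fin d → ℝ) (τ : Coin d) :
    Measurable[past Ω n] fun ω : ℕ → Ω => fourierAmplitude r (fun s => C (ω s)) φ₀ n ξ τ := by
  refine @Finset.measurable_fun_sum _ _ _ _ _ _ (past Ω n) _ _ fun k _ => ?_
  exact Measurable.mul (m := past Ω n) (@measurable_const _ _ _ (past Ω n) _)
    (measurable_past_amplitude hCmeas r φ₀ n k τ)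

omit hCmeas in
/-- The tensor product of the Fourier transform at `y` and of the conjugate of the Fourier
transform at `-y'`. -/
def fourierTensor (r : Coin d → Fin d → ℤ) (c : ℕ → Matrix (Coin d) (Coin d) ℂ)
    (φ₀ : CoinSpace d) (n : ℕ) (y y' : Fin d → ℝ) (t : Coin d × Coin d) : ℂ :=
  fourierAmplitude r c φ₀ n y t.1 * star (fourierAmplitude r c φ₀ n (-y') t.2)

lemma measurable_past_fourierTensor (n : ℕ) (y y' : Fin d → ℝ) (t : Coin d × Coin d) :
    Measurable[past Ω n] fun ω : ℕ → Ω => fourierTensor r (fun s => C (ω s)) φ₀ n y y' t :=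
  Measurable.mul (m := past Ω n) (measurable_past_fourierAmplitude hCmeas r φ₀ n y t.1)
    (continuous_star.measurable.comp (measurable_past_fourierAmplitude hCmeas r φ₀ n (-y') t.2))

-- Conjugation turns the frequency `-y'` into the phase of `y'`, which matches `D(y, y')`.
omit [MeasurableSpace Ω] hCmeas in
lemma fourierTensor_succ (c : ℕ → Matrix (Coin d) (Coin d) ℂ) (n : ℕ) (y y' : Fin d → ℝ)
    (t : Coin d × Coin d) :
    fourierTensor r c φ₀ (n + 1) y y' t = planeWave y (r t.1) * planeWave y' (r t.2) *
      ∑ s, (c n ⊗ₖ (c n).map star) t s * fourierTensor r c φ₀ n y y' s := by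
  simp only [fourierTensor, fourierAmplitude_succ, star_mul', star_planeWave, neg_neg, star_sum,
    Matrix.kroneckerMap_apply, Matrix.map_apply]
  rw [mul_mul_mul_comm, Finset.sum_mul_sum, ← Fintype.sum_prod_type']
  congr 1
  refine Finset.sum_congr rfl fun s _ => ?_
  ring

variable (hCunit : ∀ ω, C ω ∈ Matrix.unitaryGroup (Coin d) ℂ)

omit [MeasurableSpace Ω] hCmeas in
include hCunit in
lemma norm_fourierTensor_le (n : ℕ) (y y' : Fin d → ℝ) (t : Coin d × Coin d) (ω : ℕ → Ω) :
    ‖fourierTensor r (fun s => C (ω s)) φ₀ n y y' t‖ ≤ ‖φ₀‖ ^ 2 := by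
  rw [fourierTensor, norm_mul, norm_star, sq]
  gcongr <;> exact norm_fourierAmplitude_le r φ₀ (fun n => hCunit (ω n)) n _ _

variable (μ : Measure Ω) [IsProbabilityMeasure μ]

include hCunit

lemma integrable_fourierTensor (n : ℕ) (y y' : Fin d → ℝ) (t : Coin d × Coin d) :
    Integrable (fun ω : ℕ → Ω => fourierTensor r (fun s => C (ω s)) φ₀ n y y' t)
      (Measure.infinitePi fun _ : ℕ => μ) :=
  Integrable.of_bound ((measurable_past_fourierTensor hCmeas r φ₀ n y y' t).mono (past_le n)
    le_rfl).aestronglyMeasurable (‖φ₀‖ ^ 2)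
    (ae_of_all _ fun ω => norm_fourierTensor_le r φ₀ hCunit n y y' t ω)

omit hCunit in
lemma measurable_kronecker (t s : Coin d × Coin d) :
    Measurable fun ω => (C ω ⊗ₖ (C ω).map star) t s :=
  (hCmeas t.1 s.1).mul (continuous_star.measurable.comp (hCmeas t.2 s.2))

omit [MeasurableSpace Ω] hCmeas in
lemma norm_kronecker_le (t s : Coin d × Coin d) (ω : Ω) :
    ‖(C ω ⊗ₖ (C ω).map star) t s‖ ≤ 1 := by
  rw [Matrix.kroneckerMap_apply, Matrix.map_apply, norm_mul, norm_star]
  exact mul_le_one₀ (entry_norm_bound_of_unitary (hCunit ω) _ _) (norm_nonneg _)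
    (entry_norm_bound_of_unitary (hCunit ω) _ _)

-- The tensor at time `n` involves the coins of index below `n`, while the next step uses the coin
-- of index `n`.
omit hCunit in
lemma indepFun_kronecker_fourierTensor (n : ℕ) (y y' : Fin d → ℝ) (t s : Coin d × Coin d) :
    IndepFun (fun ω : ℕ → Ω => fourierTensor r (fun i => C (ω i)) φ₀ n y y' s)
      (fun ω : ℕ → Ω => (C (ω n) ⊗ₖ (C (ω n)).map star) t s)
      (Measure.infinitePi fun _ : ℕ => μ) := by
  have h : iIndepFun (fun (i : ℕ) (ω : ℕ → Ω) => ω i) (Measure.infinitePi fun _ : ℕ => μ) :=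
    iIndepFun_infinitePi (X := fun _ ω => ω) fun _ => measurable_id
  have h2 := indep_iSup_of_disjoint (fun i => (measurable_pi_apply i).comap_le) h
    (S := Set.Iio n) (T := {n}) (by simp)
  simp only [Set.mem_singleton_iff, iSup_iSup_eq_left] at h2
  refine indep_of_indep_of_le_left (indep_of_indep_of_le_right h2 ?_) ?_
  · exact ((measurable_kronecker hCmeas t s).comp
      (comap_measurable fun ω : ℕ → Ω => ω n)).comap_le
  · exact (measurable_past_fourierTensor hCmeas r φ₀ n y y' s).comap_le

/-- The mean of the tensor evolves under `ℳ(y, y')`. -/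
lemma integral_fourierTensor (n : ℕ) (y y' : Fin d → ℝ) (t : Coin d × Coin d) :
    ∫ ω : ℕ → Ω, fourierTensor r (fun s => C (ω s)) φ₀ n y y' t
      ∂(Measure.infinitePi fun _ : ℕ => μ) =
    (meanM μ C r y y' ^ n *ᵥ fun t => φ₀ t.1 * star (φ₀ t.2)) t := by
  induction n generalizing t with
  | zero => simp [fourierTensor, fourierAmplitude_zero]
  | succ n ih =>
    have hi (s : Coin d × Coin d) : ∫ ω : ℕ → Ω, (C (ω n) ⊗ₖ (C (ω n)).map star) t s *
        fourierTensor r (fun s => C (ω s)) φ₀ n y y' s ∂(Measure.infinitePi fun _ : ℕ => μ) =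
        meanTensor μ C t s * (meanM μ C r y y' ^ n *ᵥ fun t => φ₀ t.1 * star (φ₀ t.2)) s := by
      rw [← ih, (indepFun_kronecker_fourierTensor hCmeas r φ₀ μ n y y' t s).symm.integral_fun_mul_eq_mul_integral
        ((measurable_kronecker hCmeas t s).comp (measurable_pi_apply n)).aestronglyMeasurable
        (integrable_fourierTensor hCmeas r φ₀ hCunit μ n y y' s).aestronglyMeasurable]
      congr 1
      conv_rhs => rw [meanTensor, Matrix.of_apply,
        ← (measurePreserving_eval_infinitePi (fun _ : ℕ => μ) n).map_eq]
      exact (integral_map (φ := Function.eval n) (μ := Measure.infinitePi fun _ : ℕ => μ)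
        (f := fun ω => (C ω ⊗ₖ (C ω).map star) t s) (measurable_pi_apply n).aemeasurable
        (measurable_kronecker hCmeas t s).aestronglyMeasurable).symm
    simp only [fourierTensor_succ]
    rw [integral_const_mul, integral_finsetSum, pow_succ', ← Matrix.mulVec_mulVec]
    · rw [show meanM μ C r y y' *ᵥ (meanM μ C r y y' ^ n *ᵥ fun t => φ₀ t.1 * star (φ₀ t.2)) =
        phaseMatrix r y y' *ᵥ (meanTensor μ C *ᵥ (meanM μ C r y y' ^ n *ᵥ
          fun t => φ₀ t.1 * star (φ₀ t.2))) from (Matrix.mulVec_mulVec ..).symm,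
        phaseMatrix_eq, Matrix.mulVec_diagonal]
      exact congrArg _ (Finset.sum_congr rfl fun s _ => hi s)
    · intro s _
      refine (integrable_fourierTensor hCmeas r φ₀ hCunit μ n y y' s).bdd_mul (c := 1)
        ((measurable_kronecker hCmeas t s).comp (measurable_pi_apply n)).aestronglyMeasurable
        (ae_of_all _ fun ω => norm_kronecker_le hCunit t s (ω n))

/-- The orbit is a mean of tensors bounded by unitarity, so it is bounded uniformly in `n`, `y` and
`y'` without spectral information. -/
lemma norm_meanM_pow_mulVec_le (n : ℕ) (y y' : Fin d → ℝ) (t : Coin d × Coin d) :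
    ‖(meanM μ C r y y' ^ n *ᵥ fun t => φ₀ t.1 * star (φ₀ t.2)) t‖ ≤ ‖φ₀‖ ^ 2 := by
  rw [← integral_fourierTensor hCmeas r φ₀ hCunit μ]
  simpa using norm_integral_le_of_norm_le_const (μ := Measure.infinitePi fun _ : ℕ => μ)
    (ae_of_all _ fun ω => norm_fourierTensor_le r φ₀ hCunit n y y' t ω)

end Expectation

/-! ### Orthogonality of plane waves on the torus. -/

section Torus

/-- The uniform distribution on the fundamental domain `(0, 2π]^d` of the torus. -/
def torusMeasure (d : ℕ) : Measure (Fin d → ℝ) :=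
  Measure.pi fun _ => (ENNReal.ofReal (2 * Real.pi))⁻¹ •
    (volume : Measure ℝ).restrict (Set.Ioc 0 (2 * Real.pi))

instance isProbabilityMeasure_circle : IsProbabilityMeasure ((ENNReal.ofReal (2 * Real.pi))⁻¹ •
    (volume : Measure ℝ).restrict (Set.Ioc 0 (2 * Real.pi))) := by
  constructor
  simp only [Measure.smul_apply, Measure.restrict_apply_univ, Real.volume_Ioc, sub_zero,
    smul_eq_mul]
  exact ENNReal.inv_mul_cancel (by simp [Real.pi_pos]) ENNReal.ofReal_ne_top

instance isProbabilityMeasure_torusMeasure : IsProbabilityMeasure (torusMeasure d) := by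
  unfold torusMeasure
  infer_instance

lemma integral_circle_exp (m : ℤ) :
    ∫ x : ℝ, Complex.exp (Complex.I * m * x) ∂((ENNReal.ofReal (2 * Real.pi))⁻¹ •
      (volume : Measure ℝ).restrict (Set.Ioc 0 (2 * Real.pi))) = if m = 0 then 1 else 0 := by
  split_ifs with hm
  · simp only [hm, Int.cast_zero, mul_zero, zero_mul, Complex.exp_zero, integral_const,
      probReal_univ, one_smul]
  · rw [integral_smul_measure, ← intervalIntegral.integral_of_le (by positivity),
      integral_exp_mul_complex (by simp [hm])]
    have : Complex.exp (Complex.I * m * (2 * Real.pi : ℝ)) = 1 :=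
      Complex.exp_eq_one_iff.2 ⟨m, by push_cast; ring⟩
    rw [this, Complex.ofReal_zero, mul_zero, Complex.exp_zero, sub_self, zero_div, smul_zero]

lemma integral_torus_planeWave (k : Fin d → ℤ) :
    ∫ v, planeWave v k ∂(torusMeasure d) = if k = 0 then 1 else 0 := by
  have h (v : Fin d → ℝ) : planeWave v k = ∏ j, Complex.exp (Complex.I * (k j) * (v j)) := by
    rw [planeWave, ← Complex.exp_sum]
    push_cast
    rw [Finset.mul_sum]
    exact congrArg _ (Finset.sum_congr rfl fun j _ => by ring)
  simp only [h, torusMeasure]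
  rw [integral_fintype_prod_eq_prod (fun j (x : ℝ) => Complex.exp (Complex.I * (k j) * x))]
  simp only [integral_circle_exp]
  split_ifs with hk
  · simp [hk]
  · obtain ⟨j, hj⟩ := Function.ne_iff.1 hk
    exact Finset.prod_eq_zero (Finset.mem_univ j) (if_neg hj)

end Torus

/-! ### The averaged law and its characteristic function. -/

section Law

variable {Ω : Type*} [MeasurableSpace Ω] (μ : Measure Ω) [IsProbabilityMeasure μ]
  {C : Ω → Matrix (Coin d) (Coin d) ℂ} (hCmeas : ∀ σ τ, Measurable fun ω => C ω σ τ)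
  (hCunit : ∀ ω, C ω ∈ Matrix.unitaryGroup (Coin d) ℂ) (r : Coin d → Fin d → ℤ) (φ₀ : CoinSpace d)

/-- The diagonal part in the coin variable of the mean density matrix of the walker. -/
def meanDensity (C : Ω → Matrix (Coin d) (Coin d) ℂ) (n : ℕ) (k k' : Fin d → ℤ) (τ : Coin d) : ℂ :=
  ∫ ω : ℕ → Ω, amplitude r (fun s => C (ω s)) φ₀ n k τ *
    star (amplitude r (fun s => C (ω s)) φ₀ n k' τ) ∂(Measure.infinitePi fun _ : ℕ => μ)

lemma averagedDist_nonneg (n : ℕ) (k : Fin d → ℤ) : 0 ≤ averagedDist μ C r φ₀ n k :=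
  integral_nonneg fun _ => by
    rw [positionDist]
    positivity

lemma averagedDist_eq_zero {n : ℕ} {k : Fin d → ℤ} (hk : k ∉ reach r n) :
    averagedDist μ C r φ₀ n k = 0 := by
  simp [averagedDist, positionDist_eq, amplitude_eq_zero r _ φ₀ hk]

lemma integral_averagedLaw (n : ℕ) (f : (Fin d → ℤ) → ℂ) :
    ∫ k, f k ∂(averagedLaw μ C r φ₀ n) =
      ∑ k ∈ reach r n, (averagedDist μ C r φ₀ n k : ℂ) * f k := by
  rw [averagedLaw, integral_sum_dirac fun _ => ENNReal.ofReal_ne_top, tsum_eq_sum (s := reach r n)]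
  · simp [ENNReal.toReal_ofReal (averagedDist_nonneg μ r φ₀ n _)]
  · intro k hk
    simp [averagedDist_eq_zero μ r φ₀ hk]

lemma averagedLaw_univ (n : ℕ) :
    averagedLaw μ C r φ₀ n Set.univ =
      ENNReal.ofReal (∑ k ∈ reach r n, averagedDist μ C r φ₀ n k) := by
  rw [averagedLaw, Measure.sum_apply _ MeasurableSet.univ, tsum_eq_sum (s := reach r n),
    ENNReal.ofReal_sum_of_nonneg fun k _ => averagedDist_nonneg μ r φ₀ n k]
  · simp
  · intro k hk
    simp [averagedDist_eq_zero μ r φ₀ hk]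

include hCmeas hCunit

lemma integrable_amplitude_mul_star (n : ℕ) (k k' : Fin d → ℤ) (τ : Coin d) :
    Integrable (fun ω : ℕ → Ω => amplitude r (fun s => C (ω s)) φ₀ n k τ *
      star (amplitude r (fun s => C (ω s)) φ₀ n k' τ)) (Measure.infinitePi fun _ : ℕ => μ) := by
  refine Integrable.of_bound ((measurable_amplitude hCmeas r φ₀ n k τ).mul
    (continuous_star.measurable.comp (measurable_amplitude hCmeas r φ₀ n k' τ))).aestronglyMeasurable
    (((Fintype.card (Coin d) : ℝ) ^ n * ‖φ₀‖) * ((Fintype.card (Coin d) : ℝ) ^ n * ‖φ₀‖))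
    (ae_of_all _ fun ω => ?_)
  rw [norm_mul, norm_star]
  gcongr <;> exact norm_amplitude_le r φ₀ (fun n => hCunit (ω n)) n _ τ

lemma averagedDist_eq_sum (n : ℕ) (k : Fin d → ℤ) :
    (averagedDist μ C r φ₀ n k : ℂ) = ∑ τ, meanDensity μ r φ₀ C n k k τ := by
  simp only [averagedDist, meanDensity]
  rw [← integral_complex_ofReal, ← integral_finsetSum _ fun τ _ =>
    integrable_amplitude_mul_star μ hCmeas hCunit r φ₀ n k k τ]
  simp [positionDist_eq, Complex.mul_conj']

/-- With frequencies `θ - v` and `v`, the variable `v` enters only through `k' - k`, so integrating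
it out selects `k' = k`. -/
lemma meanM_pow_mulVec_eq_sum (n : ℕ) (θ v : Fin d → ℝ) (τ : Coin d) :
    (meanM μ C r (θ - v) v ^ n *ᵥ fun t => φ₀ t.1 * star (φ₀ t.2)) (τ, τ) =
      ∑ k ∈ reach r n, ∑ k' ∈ reach r n,
        planeWave θ k * meanDensity μ r φ₀ C n k k' τ * planeWave v (k' - k) := by
  rw [← integral_fourierTensor hCmeas r φ₀ hCunit μ]
  have h (ω : ℕ → Ω) : fourierTensor r (fun s => C (ω s)) φ₀ n (θ - v) v (τ, τ) =
      ∑ k ∈ reach r n, ∑ k' ∈ reach r n, planeWave θ k * planeWave v (k' - k) *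
        (amplitude r (fun s => C (ω s)) φ₀ n k τ *
          star (amplitude r (fun s => C (ω s)) φ₀ n k' τ)) := by
    simp only [fourierTensor, fourierAmplitude, star_sum, Finset.sum_mul_sum]
    refine Finset.sum_congr rfl fun k _ => Finset.sum_congr rfl fun k' _ => ?_
    rw [star_mul', star_planeWave, neg_neg, sub_eq_add_neg θ, planeWave_add_left, ← star_planeWave,
      sub_eq_add_neg k', planeWave_add]
    have : planeWave v (-k) = star (planeWave v k) := by
      rw [star_planeWave]
      simp [planeWave]
    rw [this]
    ring
  simp only [h]
  have hi (k k' : Fin d → ℤ) := (integrable_amplitude_mul_star μ hCmeas hCunit r φ₀ n k k' τ).const_mul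
    (planeWave θ k * planeWave v (k' - k))
  rw [integral_finsetSum _ fun k _ => integrable_finsetSum _ fun k' _ => hi k k']
  refine Finset.sum_congr rfl fun k _ => ?_
  rw [integral_finsetSum _ fun k' _ => hi k k']
  refine Finset.sum_congr rfl fun k' _ => ?_
  rw [integral_const_mul, meanDensity]
  ring

/-- The characteristic function of the averaged distribution, as an integral over the torus. -/
lemma sum_planeWave_mul_averagedDist (n : ℕ) (θ : Fin d → ℝ) :
    ∑ k ∈ reach r n, (averagedDist μ C r φ₀ n k : ℂ) * planeWave θ k =
      ∫ v, ∑ τ, (meanM μ C r (θ - v) v ^ n *ᵥ fun t => φ₀ t.1 * star (φ₀ t.2)) (τ, τ)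
        ∂(torusMeasure d) := by
  simp only [meanM_pow_mulVec_eq_sum μ hCmeas hCunit]
  have hi (k k' : Fin d → ℤ) (τ : Coin d) : Integrable (fun v => planeWave θ k *
      meanDensity μ r φ₀ C n k k' τ * planeWave v (k' - k)) (torusMeasure d) :=
    (Integrable.of_bound (continuous_planeWave _).aestronglyMeasurable 1
      (ae_of_all _ fun v => (norm_planeWave v _).le)).const_mul _
  rw [integral_finsetSum _ fun τ _ => integrable_finsetSum _ fun k _ =>
    integrable_finsetSum _ fun k' _ => hi k k' τ]
  simp only [averagedDist_eq_sum μ hCmeas hCunit, Finset.sum_mul]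
  rw [Finset.sum_comm]
  refine Finset.sum_congr rfl fun τ _ => ?_
  rw [integral_finsetSum _ fun k _ => integrable_finsetSum _ fun k' _ => hi k k' τ]
  refine Finset.sum_congr rfl fun k hk => ?_
  rw [integral_finsetSum _ fun k' _ => hi k k' τ]
  simp only [integral_const_mul, integral_torus_planeWave, sub_eq_zero, mul_ite, mul_one, mul_zero]
  rw [Finset.sum_ite_eq' _ k, if_pos hk, mul_comm]

/-- This is the characteristic function at `θ = 0`, where the trace in each fibre is the conserved
norm. -/
lemma sum_averagedDist (n : ℕ) :
    ∑ k ∈ reach r n, averagedDist μ C r φ₀ n k = ‖φ₀‖ ^ 2 := by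
  have h := sum_planeWave_mul_averagedDist μ hCmeas hCunit r φ₀ n 0
  have h2 (v : Fin d → ℝ) : ∑ τ, (meanM μ C r (0 - v) v ^ n *ᵥ
      fun t => φ₀ t.1 * star (φ₀ t.2)) (τ, τ) = ((‖φ₀‖ ^ 2 : ℝ) : ℂ) := by
    simp only [← integral_fourierTensor hCmeas r φ₀ hCunit μ]
    rw [← integral_finsetSum _ fun τ _ =>
      integrable_fourierTensor hCmeas r φ₀ hCunit μ n (0 - v) v (τ, τ)]
    have h3 (ω : ℕ → Ω) : ∑ τ, fourierTensor r (fun s => C (ω s)) φ₀ n (0 - v) v (τ, τ) =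
        ((‖φ₀‖ ^ 2 : ℝ) : ℂ) := by
      rw [← sum_norm_sq_fourierAmplitude r φ₀ (fun n => hCunit (ω n)) n (-v)]
      simp [fourierTensor, Complex.mul_conj']
    simp only [h3, integral_const, probReal_univ, one_smul]
  simp only [h2, planeWave_zero_left, mul_one] at h
  simp only [integral_const, probReal_univ, one_smul] at h
  exact_mod_cast h

lemma isProbabilityMeasure_averagedLaw (hφ₀ : ‖φ₀‖ = 1) (n : ℕ) :
    IsProbabilityMeasure (averagedLaw μ C r φ₀ n) :=
  ⟨by rw [averagedLaw_univ, sum_averagedDist μ hCmeas hCunit, hφ₀]; simp⟩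

end Law

/-! ### Approximate eigenvectors in place of analytic perturbation theory. -/

section Perturbation

open Asymptotics

variable {ι : Type*} [Fintype ι] [DecidableEq ι]

lemma exp_I_mul_sub_isLittleO (s : ℝ) :
    (fun ε : ℝ => Complex.exp (Complex.I * ((ε * s : ℝ) : ℂ)) -
      (1 + Complex.I * ε * s - (ε : ℂ) ^ 2 * s ^ 2 / 2)) =o[𝓝 0] fun ε : ℝ => ε ^ 2 := by
  have h1 : Tendsto (fun ε : ℝ => Complex.I * ((ε * s : ℝ) : ℂ)) (𝓝 0) (𝓝 0) := by
    have : Continuous fun ε : ℝ => Complex.I * ((ε * s : ℝ) : ℂ) := by fun_prop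
    simpa using this.tendsto 0
  have h2 := (Complex.exp_sub_sum_range_succ_isLittleO_pow 2).comp_tendsto h1
  have h3 : ((fun x : ℂ => x ^ 2) ∘ fun ε : ℝ => Complex.I * ((ε * s : ℝ) : ℂ)) =O[𝓝 0]
      fun ε : ℝ => ε ^ 2 := by
    refine IsBigO.of_bound (s ^ 2) (Eventually.of_forall fun ε => ?_)
    simp [mul_pow, mul_comm]
  refine (h2.trans_isBigO h3).congr_left fun ε => ?_
  simp only [Function.comp_apply, Finset.sum_range_succ, Finset.sum_range_zero]
  simp [mul_pow, Nat.factorial]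
  ring

lemma exp_neg_sq_sub_isLittleO (q : ℝ) :
    (fun ε : ℝ => Complex.exp (-((ε ^ 2 * q : ℝ) : ℂ) / 2) - (1 - (ε : ℂ) ^ 2 * q / 2))
      =o[𝓝 0] fun ε : ℝ => ε ^ 2 := by
  have h1 : Tendsto (fun ε : ℝ => -((ε ^ 2 * q : ℝ) : ℂ) / 2) (𝓝 0) (𝓝 0) := by
    have : Continuous fun ε : ℝ => -((ε ^ 2 * q : ℝ) : ℂ) / 2 := by fun_prop
    simpa using this.tendsto 0
  have h2 := (Complex.exp_sub_sum_range_succ_isLittleO_pow 1).comp_tendsto h1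
  have h3 : ((fun x : ℂ => x ^ 1) ∘ fun ε : ℝ => -((ε ^ 2 * q : ℝ) : ℂ) / 2) =O[𝓝 0]
      fun ε : ℝ => ε ^ 2 := by
    refine IsBigO.of_bound (|q| / 2) (Eventually.of_forall fun ε => ?_)
    simp only [Function.comp_apply, pow_one, norm_div, norm_neg, Complex.norm_real, norm_mul,
      norm_pow, Complex.norm_ofNat, Real.norm_eq_abs]
    exact le_of_eq (by ring)
  refine (h2.trans_isBigO h3).congr_left fun ε => ?_
  simp [Finset.sum_range_succ]
  ring

/-- The diagonal matrix `exp (i ε F)` where `F` is the diagonal matrix with entries `s`. -/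
def expDiagonal (s : ι → ℝ) (ε : ℝ) : Matrix ι ι ℂ :=
  Matrix.diagonal fun t => Complex.exp (Complex.I * ((ε * s t : ℝ) : ℂ))

/-- A left eigenvector of `exp (i ε F) M` up to an error of order `o(ε²)`, from the solutions of
the first two equations of perturbation theory. -/
lemma approximate_eigenvector (M : Matrix ι ι ℂ) (s : ι → ℝ) (q : ℝ) (ψ ℓ₁ ℓ₂ : ι → ℂ)
    (h0 : ψ ᵥ* M = ψ)
    (h1 : (fun t => Complex.I * (ψ t * s t)) ᵥ* M + ℓ₁ ᵥ* M = ℓ₁)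
    (h2 : (fun t => -(ψ t * s t ^ 2) / 2) ᵥ* M + (fun t => Complex.I * (ℓ₁ t * s t)) ᵥ* M
      + ℓ₂ ᵥ* M = ℓ₂ - ((q : ℂ) / 2) • ψ) (t : ι) :
    (fun ε : ℝ => ((ψ + (ε : ℂ) • ℓ₁ + (ε : ℂ) ^ 2 • ℓ₂) ᵥ* (expDiagonal s ε * M)
      - Complex.exp (-((ε ^ 2 * q : ℝ) : ℂ) / 2) • (ψ + (ε : ℂ) • ℓ₁ + (ε : ℂ) ^ 2 • ℓ₂)) t)
      =o[𝓝 0] fun ε : ℝ => ε ^ 2 := by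
  set ρ : ι → ℝ → ℂ := fun t ε => Complex.exp (Complex.I * ((ε * s t : ℝ) : ℂ)) -
      (1 + Complex.I * ε * s t - (ε : ℂ) ^ 2 * s t ^ 2 / 2) with hρ
  set κ : ℝ → ℂ := fun ε => Complex.exp (-((ε ^ 2 * q : ℝ) : ℂ) / 2) - (1 - (ε : ℂ) ^ 2 * q / 2)
    with hκ
  -- The three equations cancel the coefficients of `1`, `ε` and `ε²`. What remains is the two
  -- Taylor remainders `ρ` and `κ`, and terms divisible by `ε³`.
  have hid (ε : ℝ) : ((ψ + (ε : ℂ) • ℓ₁ + (ε : ℂ) ^ 2 • ℓ₂) ᵥ* (expDiagonal s ε * M)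
      - Complex.exp (-((ε ^ 2 * q : ℝ) : ℂ) / 2) • (ψ + (ε : ℂ) • ℓ₁ + (ε : ℂ) ^ 2 • ℓ₂)) t =
      ∑ a, ρ a ε * ((ψ a + ε * ℓ₁ a + ε ^ 2 * ℓ₂ a) * M a t)
      + (ε : ℂ) ^ 3 * (∑ a, (-(ℓ₁ a * s a ^ 2) / 2 + Complex.I * (ℓ₂ a * s a)
          - ε * (ℓ₂ a * s a ^ 2 / 2)) * M a t + (q : ℂ) / 2 * (ℓ₁ t + ε * ℓ₂ t))
      - κ ε * (ψ t + ε * ℓ₁ t + ε ^ 2 * ℓ₂ t) := by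
    have e0 := congrFun h0 t
    have e1 := congrFun h1 t
    have e2 := congrFun h2 t
    simp only [Matrix.vecMul, dotProduct, Pi.add_apply, Pi.sub_apply, Pi.smul_apply, smul_eq_mul]
      at e0 e1 e2
    have e3 : ((ψ + (ε : ℂ) • ℓ₁ + (ε : ℂ) ^ 2 • ℓ₂) ᵥ* (expDiagonal s ε * M)) t =
        ∑ a, ρ a ε * ((ψ a + ε * ℓ₁ a + ε ^ 2 * ℓ₂ a) * M a t)
        + (ε : ℂ) ^ 3 * (∑ a, (-(ℓ₁ a * s a ^ 2) / 2 + Complex.I * (ℓ₂ a * s a)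
          - ε * (ℓ₂ a * s a ^ 2 / 2)) * M a t)
        + ∑ a, ψ a * M a t
        + ε * (∑ a, Complex.I * (ψ a * s a) * M a t + ∑ a, ℓ₁ a * M a t)
        + ε ^ 2 * (∑ a, -(ψ a * s a ^ 2) / 2 * M a t + ∑ a, Complex.I * (ℓ₁ a * s a) * M a t
          + ∑ a, ℓ₂ a * M a t) := by
      simp only [Finset.mul_sum, ← Finset.sum_add_distrib, Matrix.vecMul, dotProduct, expDiagonal,
        Matrix.diagonal_mul, Pi.add_apply, Pi.smul_apply, smul_eq_mul]
      refine Finset.sum_congr rfl fun a _ => ?_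
      simp only [hρ]
      ring
    rw [Pi.sub_apply, e3, e0, e1, e2]
    simp only [hκ, Pi.add_apply, Pi.smul_apply, smul_eq_mul]
    ring
  refine IsLittleO.congr_left ?_ fun ε => (hid ε).symm
  have hb (f : ℝ → ℂ) (hf : Continuous f) : f =O[𝓝 0] fun _ : ℝ => (1 : ℝ) :=
    (hf.tendsto 0).isBigO_one ℝ
  refine (IsLittleO.add ?_ ?_).sub ?_
  · refine IsLittleO.fun_sum fun a _ => ?_
    exact ((exp_I_mul_sub_isLittleO (s a)).mul_isBigO
      (hb (fun ε => (ψ a + ε * ℓ₁ a + ε ^ 2 * ℓ₂ a) * M a t) (by fun_prop))).congr_right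
      fun _ => mul_one _
  · have h3 : (fun ε : ℝ => (ε : ℂ) ^ 3) =o[𝓝 0] fun ε : ℝ => ε ^ 2 := by
      have := (isLittleO_pow_pow (𝕜 := ℝ) (show 2 < 3 by norm_num)).norm_left
      exact IsLittleO.of_norm_left (this.congr_left fun ε => by simp)
    simpa using h3.mul_isBigO (hb (fun ε => ∑ a, (-(ℓ₁ a * s a ^ 2) / 2 + Complex.I * (ℓ₂ a * s a)
          - ε * (ℓ₂ a * s a ^ 2 / 2)) * M a t + (q : ℂ) / 2 * (ℓ₁ t + ε * ℓ₂ t)) (by fun_prop))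
  · exact ((exp_neg_sq_sub_isLittleO q).mul_isBigO
      (hb (fun ε => ψ t + ε * ℓ₁ t + ε ^ 2 * ℓ₂ t) (by fun_prop))).congr_right fun _ => mul_one _

omit [DecidableEq ι] in
lemma norm_dotProduct_le {x y : ι → ℂ} (hy : ∀ t, ‖y t‖ ≤ 1) : ‖x ⬝ᵥ y‖ ≤ ∑ t, ‖x t‖ := by
  refine norm_sum_le_of_le _ fun t _ => ?_
  rw [norm_mul]
  exact mul_le_of_le_one_right (norm_nonneg _) (hy t)

/-- An approximate left eigenvector controls the orbits of a power bounded matrix. -/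
lemma norm_dotProduct_pow_mulVec_sub_le (B : Matrix ι ι ℂ) (ℓ w : ι → ℂ) {m : ℂ} (hm : ‖m‖ ≤ 1)
    (hB : ∀ j t, ‖(B ^ j *ᵥ w) t‖ ≤ 1) (n : ℕ) :
    ‖ℓ ⬝ᵥ (B ^ n *ᵥ w) - m ^ n * (ℓ ⬝ᵥ w)‖ ≤ n * ∑ t, ‖(ℓ ᵥ* B - m • ℓ) t‖ := by
  induction n with
  | zero => simp
  | succ n ih =>
    -- Telescoping: one application of `B` adds one defect, tested on the bounded orbit, and `‖m‖ ≤
    -- 1` does not amplify the earlier ones.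
    have h : ℓ ⬝ᵥ (B ^ (n + 1) *ᵥ w) - m ^ (n + 1) * (ℓ ⬝ᵥ w) =
        (ℓ ᵥ* B - m • ℓ) ⬝ᵥ (B ^ n *ᵥ w) + m * (ℓ ⬝ᵥ (B ^ n *ᵥ w) - m ^ n * (ℓ ⬝ᵥ w)) := by
      rw [pow_succ' B, ← Matrix.mulVec_mulVec, Matrix.dotProduct_mulVec ℓ B, sub_dotProduct,
        smul_dotProduct, smul_eq_mul]
      ring
    rw [h]
    refine (norm_add_le _ _).trans ?_
    rw [norm_mul, Nat.cast_add, Nat.cast_one, add_mul, one_mul, add_comm]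
    exact add_le_add ((mul_le_of_le_one_left (norm_nonneg _) hm).trans ih)
      (norm_dotProduct_le (hB n))

/-- Replacing `ψ` by the approximate eigenvector costs `o(1)` because the orbit is bounded;
iterating then costs `n · o(1/n)`. -/
lemma tendsto_dotProduct_expDiagonal_pow (M : Matrix ι ι ℂ) (s : ι → ℝ) {q : ℝ} (hq : 0 ≤ q)
    (ψ ℓ₁ ℓ₂ w : ι → ℂ) (h0 : ψ ᵥ* M = ψ)
    (h1 : (fun t => Complex.I * (ψ t * s t)) ᵥ* M + ℓ₁ ᵥ* M = ℓ₁)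
    (h2 : (fun t => -(ψ t * s t ^ 2) / 2) ᵥ* M + (fun t => Complex.I * (ℓ₁ t * s t)) ᵥ* M
      + ℓ₂ ᵥ* M = ℓ₂ - ((q : ℂ) / 2) • ψ)
    (hB : ∀ ε j t, ‖((expDiagonal s ε * M) ^ j *ᵥ w) t‖ ≤ 1) :
    Tendsto (fun n : ℕ => ψ ⬝ᵥ ((expDiagonal s (√(n : ℝ))⁻¹ * M) ^ n *ᵥ w)) atTop
      (𝓝 (Complex.exp (-(q : ℂ) / 2) * (ψ ⬝ᵥ w))) := by
  have hε : Tendsto (fun n : ℕ => (√(n : ℝ))⁻¹) atTop (𝓝 0) :=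
    (Real.tendsto_sqrt_atTop.comp tendsto_natCast_atTop_atTop).inv_tendsto_atTop
  set ℓ : ℝ → ι → ℂ := fun ε => ψ + (ε : ℂ) • ℓ₁ + (ε : ℂ) ^ 2 • ℓ₂ with hℓ
  have hℓ0 : Tendsto (fun n : ℕ => ℓ (√(n : ℝ))⁻¹) atTop (𝓝 ψ) := by
    have hcont : Continuous ℓ := by fun_prop
    have := (hcont.tendsto 0).comp hε
    rwa [show ℓ 0 = ψ by simp [hℓ]] at this
  have hlim1 : Tendsto (fun n : ℕ => Complex.exp (-(q : ℂ) / 2) * (ℓ (√(n : ℝ))⁻¹ ⬝ᵥ w)) atTop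
      (𝓝 (Complex.exp (-(q : ℂ) / 2) * (ψ ⬝ᵥ w))) := by
    have hcont : Continuous fun x : ι → ℂ => Complex.exp (-(q : ℂ) / 2) * (x ⬝ᵥ w) := by fun_prop
    exact (hcont.tendsto ψ).comp hℓ0
  have hlim2 : Tendsto (fun n : ℕ => (ψ - ℓ (√(n : ℝ))⁻¹) ⬝ᵥ
      ((expDiagonal s (√(n : ℝ))⁻¹ * M) ^ n *ᵥ w)) atTop (𝓝 0) := by
    refine squeeze_zero_norm (a := fun n : ℕ => ∑ t, ‖(ψ - ℓ (√(n : ℝ))⁻¹) t‖)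
      (fun n => norm_dotProduct_le (hB _ n)) ?_
    have hcont : Continuous fun x : ι → ℂ => ∑ t, ‖(ψ - x) t‖ := by
      simp only [Pi.sub_apply]
      fun_prop
    have := (hcont.tendsto ψ).comp hℓ0
    rwa [show ∑ t, ‖(ψ - ψ) t‖ = 0 by simp] at this
  have hlim3 : Tendsto (fun n : ℕ => ℓ (√(n : ℝ))⁻¹ ⬝ᵥ
      ((expDiagonal s (√(n : ℝ))⁻¹ * M) ^ n *ᵥ w) -
      Complex.exp (-(q : ℂ) / 2) * (ℓ (√(n : ℝ))⁻¹ ⬝ᵥ w)) atTop (𝓝 0) := by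
    refine squeeze_zero_norm' (a := fun n : ℕ => ∑ t, n * ‖(ℓ (√(n : ℝ))⁻¹ ᵥ*
      (expDiagonal s (√(n : ℝ))⁻¹ * M) - Complex.exp (-((((√(n : ℝ))⁻¹) ^ 2 * q : ℝ) : ℂ) / 2) •
        ℓ (√(n : ℝ))⁻¹) t‖) ?_ ?_
    · filter_upwards [eventually_gt_atTop 0] with n hn
      have hn' : (n : ℝ) ≠ 0 := by positivity
      -- Since `ε² n = 1` for `n > 0`, the power of the multiplier is exactly the limiting factor.
      have hpow : Complex.exp (-((((√(n : ℝ))⁻¹) ^ 2 * q : ℝ) : ℂ) / 2) ^ n =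
          Complex.exp (-(q : ℂ) / 2) := by
        rw [← Complex.exp_nat_mul, inv_pow, Real.sq_sqrt (Nat.cast_nonneg n)]
        congr 1
        push_cast
        have : (n : ℂ) ≠ 0 := by exact_mod_cast hn'
        field_simp
      rw [← Finset.mul_sum, ← hpow]
      refine norm_dotProduct_pow_mulVec_sub_le _ _ _ ?_ (hB _) n
      rw [Complex.norm_exp, Real.exp_le_one_iff]
      have : (-((((√(n : ℝ))⁻¹) ^ 2 * q : ℝ) : ℂ) / 2) =
          ((-(((√(n : ℝ))⁻¹) ^ 2 * q) / 2 : ℝ) : ℂ) := by push_cast; ring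
      rw [this, Complex.ofReal_re]
      have : 0 ≤ ((√(n : ℝ))⁻¹) ^ 2 * q := by positivity
      linarith
    · rw [show (0 : ℝ) = ∑ _t : ι, 0 by simp]
      refine tendsto_finsetSum _ fun t _ => ?_
      have h := ((approximate_eigenvector M s q ψ ℓ₁ ℓ₂ h0 h1 h2 t).comp_tendsto hε).norm_left
      refine h.tendsto_div_nhds_zero.congr fun n => ?_
      simp only [Function.comp_apply, inv_pow, Real.sq_sqrt (Nat.cast_nonneg n), div_inv_eq_mul]
      rw [mul_comm]
  refine (((hlim2.add hlim3).add hlim1).congr fun n => ?_).trans (by simp)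
  rw [sub_dotProduct]
  ring

end Perturbation

/-! ### The reduced resolvent and the solvability conditions. -/

section ReducedResolvent

variable {ι : Type*} [Fintype ι] [DecidableEq ι]

/-- A kernel vector is killed by `P`, hence fixed by `M`. Geometric multiplicity is at most the
algebraic one, so it is a multiple of `ψ`, which `P` fixes; it is therefore zero. -/
lemma isUnit_det_sub_one {M P : Matrix ι ι ℂ} {ψ : ι → ℂ} (hM : M *ᵥ ψ = ψ) (hPψ : P *ᵥ ψ = ψ)
    (hPM : P * M = P) (hPP : P * P = P) (hψ : ψ ≠ 0)
    (h1 : M.charpoly.rootMultiplicity 1 = 1) : IsUnit (M - P - 1).det := by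
  rw [isUnit_iff_ne_zero]
  intro hdet
  obtain ⟨x, hx, hx0⟩ := Matrix.exists_mulVec_eq_zero_iff.2 hdet
  have hPx : P *ᵥ x = 0 := by
    have h : P *ᵥ ((M - P - 1) *ᵥ x) = -(P *ᵥ x) := by
      rw [Matrix.mulVec_mulVec, mul_sub, mul_sub, hPM, hPP, sub_self, zero_sub, mul_one,
        Matrix.neg_mulVec]
    rw [hx0, Matrix.mulVec_zero] at h
    simpa using h.symm
  have hMx : M *ᵥ x = x := by
    rw [Matrix.sub_mulVec, Matrix.sub_mulVec, hPx, sub_zero, Matrix.one_mulVec, sub_eq_zero] at hx0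
    exact hx0
  have hrank := LinearMap.finrank_eigenspace_le (Matrix.toLin' M) 1
  rw [Matrix.charpoly_toLin', h1, finrank_le_one_iff] at hrank
  obtain ⟨u, hu⟩ := hrank
  have hmem {z : ι → ℂ} (hz : M *ᵥ z = z) : z ∈ Module.End.eigenspace (Matrix.toLin' M) 1 := by
    rw [Module.End.mem_eigenspace_iff, Matrix.toLin'_apply, hz, one_smul]
  obtain ⟨a, ha⟩ := hu ⟨ψ, hmem hM⟩
  obtain ⟨b, hb⟩ := hu ⟨x, hmem hMx⟩
  have ha' : a • (u : ι → ℂ) = ψ := congrArg Subtype.val ha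
  have hb' : b • (u : ι → ℂ) = x := congrArg Subtype.val hb
  have ha0 : a ≠ 0 := by
    rintro rfl
    exact hψ (by rw [← ha', zero_smul])
  have hxψ : x = (b / a) • ψ := by rw [← ha', ← hb', smul_smul, div_mul_cancel₀ _ ha0]
  apply hx
  rw [hxψ, Matrix.mulVec_smul, hPψ, ← hxψ] at hPx
  exact hPx

/-- Subtracting `P` moves the eigenvalue on its range from `1` to `0` and changes nothing on the
complement. So the regular part is `(M - P - z)⁻¹ (1 - P)`, continuous at `z = 1`. -/
lemma tendsto_reduced_resolvent {M P : Matrix ι ι ℂ} (hPM : P * M = P) (hMP : M * P = P)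
    (hPP : P * P = P) (hdet : IsUnit (M - P - 1).det) :
    Tendsto (fun z : ℂ => (M - z • (1 : Matrix ι ι ℂ))⁻¹ - (1 - z)⁻¹ • P) (𝓝[≠] 1)
      (𝓝 ((M - P - 1)⁻¹ * (1 - P))) := by
  have hcont : Continuous fun z : ℂ => M - P - z • (1 : Matrix ι ι ℂ) := by fun_prop
  have hinv : Tendsto (fun z : ℂ => (M - P - z • (1 : Matrix ι ι ℂ))⁻¹ * (1 - P)) (𝓝 1)
      (𝓝 ((M - P - 1)⁻¹ * (1 - P))) := by
    have h : ContinuousAt (fun z : ℂ => (M - P - z • (1 : Matrix ι ι ℂ))⁻¹) 1 := by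
      refine ContinuousAt.comp (f := fun z : ℂ => M - P - z • (1 : Matrix ι ι ℂ))
        (continuousAt_matrix_inv _ ?_) hcont.continuousAt
      rw [one_smul, Ring.inverse_eq_inv']
      exact continuousAt_inv₀ hdet.ne_zero
    simpa using h.tendsto.mul_const (1 - P)
  refine (hinv.mono_left nhdsWithin_le_nhds).congr' ?_
  have hev : ∀ᶠ z : ℂ in 𝓝 1, (M - P - z • (1 : Matrix ι ι ℂ)).det ≠ 0 :=
    (hcont.matrix_det.tendsto 1).eventually_ne (by simpa using hdet.ne_zero)
  filter_upwards [nhdsWithin_le_nhds hev, self_mem_nhdsWithin] with z hz hz1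
  have hz1' : (1 : ℂ) - z ≠ 0 := sub_ne_zero.2 (Ne.symm hz1)
  set X : Matrix ι ι ℂ := M - P - z • (1 : Matrix ι ι ℂ) with hX
  have hu : IsUnit X.det := isUnit_iff_ne_zero.2 hz
  have hcomm : P * X = X * P := by
    simp [hX, mul_sub, sub_mul, hPM, hMP]
  have hPX : P * X⁻¹ = X⁻¹ * P := by
    calc P * X⁻¹ = X⁻¹ * (X * P) * X⁻¹ := by
          rw [← mul_assoc, Matrix.nonsing_inv_mul _ hu, one_mul]
      _ = X⁻¹ * P := by
          rw [← hcomm, mul_assoc, mul_assoc, Matrix.mul_nonsing_inv _ hu, mul_one]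
  have hMX : M - z • (1 : Matrix ι ι ℂ) = X + P := by
    rw [hX]
    abel
  have hzP : (M - z • (1 : Matrix ι ι ℂ)) * P = (1 - z) • P := by
    rw [sub_mul, hMP, smul_mul_assoc, one_mul, sub_smul, one_smul]
  symm
  rw [sub_eq_iff_eq_add]
  refine Matrix.inv_eq_right_inv ?_
  rw [mul_add, mul_smul_comm, hzP, smul_smul, inv_mul_cancel₀ hz1', one_smul, hMX, add_mul,
    ← mul_assoc, ← mul_assoc, Matrix.mul_nonsing_inv _ hu, hPX, one_mul, mul_assoc X⁻¹, mul_sub P,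
    mul_one, hPP, sub_self, mul_zero, add_zero, sub_add_cancel]

lemma reduced_resolvent_identities {M P : Matrix ι ι ℂ} (hPM : P * M = P) (hMP : M * P = P)
    (hPP : P * P = P) (hdet : IsUnit (M - P - 1).det) :
    (M - P - 1)⁻¹ * (1 - P) * (M - 1) = 1 - P ∧ (M - P - 1)⁻¹ * (1 - P) * P = 0 ∧
      P * ((M - P - 1)⁻¹ * (1 - P)) = 0 := by
  have h1 : (1 - P) * (M - 1) = (M - P - 1) * (1 - P) := by
    simp only [mul_sub, sub_mul, mul_one, one_mul, hPM, hMP, hPP]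
    abel
  have h2 : (1 - P) * P = 0 := by rw [sub_mul, one_mul, hPP, sub_self]
  have h3 : P * (M - P - 1) = -P := by rw [mul_sub, mul_sub, hPM, hPP, sub_self, zero_sub, mul_one]
  refine ⟨?_, ?_, ?_⟩
  · rw [mul_assoc, h1, ← mul_assoc, Matrix.nonsing_inv_mul _ hdet, one_mul]
  · rw [mul_assoc, h2, mul_zero]
  · have h4 : P * (M - P - 1)⁻¹ = -P := by
      calc P * (M - P - 1)⁻¹ = -(P * (M - P - 1)) * (M - P - 1)⁻¹ := by rw [h3, neg_neg]
        _ = -P := by rw [neg_mul, mul_assoc, Matrix.mul_nonsing_inv _ hdet, mul_one]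
    rw [← mul_assoc, h4, neg_mul, mul_sub, mul_one, hPP, sub_self, neg_zero]

/-- The first two equations of perturbation theory are solvable. -/
lemma exists_perturbation_solution {M P S : Matrix ι ι ℂ} {ψ : ι → ℂ} (hM : M *ᵥ ψ = ψ)
    (hS : S * (M - 1) = 1 - P) {N : ℂ}
    (hP : ∀ x : ι → ℂ, x ᵥ* P = (N⁻¹ * (x ⬝ᵥ ψ)) • ψ) (s : ι → ℝ) (q : ℝ)
    (hs : (fun t => ψ t * s t) ⬝ᵥ ψ = 0)
    (hq : (q : ℂ) * (ψ ⬝ᵥ ψ) = -(∑ t, ψ t * s t ^ 2 * ψ t) -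
      2 * (((fun t => ψ t * s t) ᵥ* S) ⬝ᵥ fun t => ψ t * s t)) :
    ∃ ℓ₁ ℓ₂ : ι → ℂ, (fun t => Complex.I * (ψ t * s t)) ᵥ* M + ℓ₁ ᵥ* M = ℓ₁ ∧
      (fun t => -(ψ t * s t ^ 2) / 2) ᵥ* M + (fun t => Complex.I * (ℓ₁ t * s t)) ᵥ* M
        + ℓ₂ ᵥ* M = ℓ₂ - ((q : ℂ) / 2) • ψ := by
  set f : ι → ℂ := fun t => ψ t * s t with hf
  -- The equation is `ℓ₁ (M - 1) = -i f M`. As `f P = 0`, `S` inverts `M - 1` on `f`; writing `f M =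
  -- f + f (M - 1)` yields `S + 1`.
  set ℓ₁ : ι → ℂ := -Complex.I • (f ᵥ* (S + 1)) with hℓ₁
  set b : ι → ℂ := (fun t => -(ψ t * s t ^ 2) / 2) ᵥ* M + (fun t => Complex.I * (ℓ₁ t * s t)) ᵥ* M
    + ((q : ℂ) / 2) • ψ with hb
  have hdot (x : ι → ℂ) : (x ᵥ* M) ⬝ᵥ ψ = x ⬝ᵥ ψ := by rw [← Matrix.dotProduct_mulVec, hM]
  refine ⟨ℓ₁, -(b ᵥ* S), ?_, ?_⟩
  · have h1 : (S + 1) * M = S + 1 + (M - P) := by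
      have : S * M = S + (1 - P) := by rw [← hS, mul_sub, mul_one]; abel
      rw [add_mul, one_mul, this]
      abel
    have h2 : (fun t => Complex.I * (ψ t * s t)) = Complex.I • f := rfl
    have h3 : f ᵥ* P = 0 := by rw [hP, hs, mul_zero, zero_smul]
    rw [h2, hℓ₁, Matrix.smul_vecMul, Matrix.smul_vecMul, Matrix.vecMul_vecMul, h1,
      Matrix.vecMul_add (S + 1), Matrix.vecMul_sub, h3, sub_zero]
    module
  -- The equation `ℓ₂ (M - 1) = -b` is solved through `S` once `b P = 0`; this condition is what
  -- determines `q`.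
  · have hbψ : b ⬝ᵥ ψ = 0 := by
      have h1 (t : ι) : Complex.I * (ℓ₁ t * s t) = (f ᵥ* S) t * s t + ψ t * s t ^ 2 := by
        rw [hℓ₁, Matrix.vecMul_add, Matrix.vecMul_one, Pi.smul_apply, Pi.add_apply, smul_eq_mul]
        linear_combination (-((f ᵥ* S) t + f t) * s t) * Complex.I_sq
      have h2 : (fun t => Complex.I * (ℓ₁ t * s t)) ⬝ᵥ ψ =
          (f ᵥ* S) ⬝ᵥ f + ∑ t, ψ t * s t ^ 2 * ψ t := by
        simp only [h1, dotProduct, ← Finset.sum_add_distrib]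
        refine Finset.sum_congr rfl fun t _ => ?_
        simp only [hf]
        ring
      have h3 : (fun t => -(ψ t * s t ^ 2) / 2) ⬝ᵥ ψ = -(∑ t, ψ t * s t ^ 2 * ψ t) / 2 := by
        rw [dotProduct, neg_div, Finset.sum_div, ← Finset.sum_neg_distrib]
        exact Finset.sum_congr rfl fun t _ => by ring
      rw [hb, add_dotProduct, add_dotProduct, hdot, hdot, h2, h3, smul_dotProduct, smul_eq_mul]
      linear_combination hq / 2
    have hbP : b ᵥ* P = 0 := by rw [hP, hbψ, mul_zero, zero_smul]
    have h4 : (b ᵥ* S) ᵥ* M = b ᵥ* S + b := by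
      have : S * M = S + (1 - P) := by rw [← hS, mul_sub, mul_one]; abel
      rw [Matrix.vecMul_vecMul, this, Matrix.vecMul_add, Matrix.vecMul_sub, hbP, sub_zero,
        Matrix.vecMul_one]
    rw [Matrix.neg_vecMul, h4]
    nth_rewrite 2 [hb]
    abel

end ReducedResolvent

/-! ### The maximally entangled vector and its projection. -/

section PsiOne

@[simp]
lemma sum_psiOne_mul (g : Coin d × Coin d → ℂ) : ∑ t, psiOne d t * g t = ∑ τ, g (τ, τ) := by
  simp [psiOne, Fintype.sum_prod_type (α₁ := Coin d) (α₂ := Coin d)]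

lemma psiOne_dotProduct (g : Coin d × Coin d → ℂ) : psiOne d ⬝ᵥ g = ∑ τ, g (τ, τ) :=
  sum_psiOne_mul g

@[simp]
lemma psiOne_diag (τ : Coin d) : psiOne d (τ, τ) = 1 := if_pos rfl

lemma star_psiOne : star (psiOne d) = psiOne d := by
  funext t
  simp [psiOne, apply_ite]

lemma psiOne_dotProduct_self : psiOne d ⬝ᵥ psiOne d = 2 * (d : ℂ) := by
  simp [psiOne_dotProduct, mul_comm]

lemma vecMul_projP (x : Coin d × Coin d → ℂ) :
    x ᵥ* projP d = ((2 * (d : ℂ))⁻¹ * (x ⬝ᵥ psiOne d)) • psiOne d := by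
  rw [projP, star_psiOne, Matrix.vecMul_smul, Matrix.vecMul_vecMulVec, smul_smul]

lemma projP_mulVec_psiOne (hd : d ≠ 0) : projP d *ᵥ psiOne d = psiOne d := by
  have : (d : ℂ) ≠ 0 := by exact_mod_cast hd
  rw [projP, star_psiOne, Matrix.smul_mulVec, Matrix.vecMulVec_mulVec, psiOne_dotProduct_self]
  funext t
  simp
  field_simp

lemma projP_mul {M : Matrix (Coin d × Coin d) (Coin d × Coin d) ℂ}
    (hM : psiOne d ᵥ* M = psiOne d) : projP d * M = projP d := by
  rw [projP, star_psiOne, smul_mul_assoc, Matrix.vecMulVec_mul, hM]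

lemma mul_projP {M : Matrix (Coin d × Coin d) (Coin d × Coin d) ℂ}
    (hM : M *ᵥ psiOne d = psiOne d) : M * projP d = projP d := by
  rw [projP, star_psiOne, mul_smul_comm, Matrix.mul_vecMulVec, hM]

end PsiOne

/-! ### Invariance of `Ψ₁` and the reduced resolvent of the walk. -/

section Stationary

variable {Ω : Type*} [MeasurableSpace Ω] (μ : Measure Ω) [IsProbabilityMeasure μ]
  {C : Ω → Matrix (Coin d) (Coin d) ℂ} (hCmeas : ∀ σ τ, Measurable fun ω => C ω σ τ)
  (hCunit : ∀ ω, C ω ∈ Matrix.unitaryGroup (Coin d) ℂ) (r : Coin d → Fin d → ℤ)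

lemma phase_diag (v : Fin d → ℝ) (τ : Coin d) :
    planeWave (-v) (r τ) * planeWave v (r τ) = 1 := by
  rw [← planeWave_add_left, neg_add_cancel, planeWave_zero_left]

include hCmeas hCunit

lemma integrable_kronecker (t s : Coin d × Coin d) :
    Integrable (fun ω => (C ω ⊗ₖ (C ω).map star) t s) μ :=
  Integrable.of_bound (measurable_kronecker hCmeas t s).aestronglyMeasurable 1
    (ae_of_all _ fun ω => norm_kronecker_le hCunit t s ω)

/-- This is the mean of `C C* = 1`; the left version below is the mean of `C* C = 1`. -/
lemma meanTensor_mulVec_psiOne : meanTensor μ C *ᵥ psiOne d = psiOne d := by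
  funext t
  rw [Matrix.mulVec, dotProduct_comm, psiOne_dotProduct]
  simp only [meanTensor, Matrix.of_apply]
  rw [← integral_finsetSum _ fun τ _ => integrable_kronecker μ hCmeas hCunit t (τ, τ)]
  have h (ω : Ω) : ∑ τ, (C ω ⊗ₖ (C ω).map star) t (τ, τ) = psiOne d t := by
    have := congrFun (congrFun (Matrix.mem_unitaryGroup_iff.1 (hCunit ω)) t.1) t.2
    rw [Matrix.mul_apply, Matrix.one_apply] at this
    exact this
  simp only [h, integral_const, probReal_univ, one_smul]

lemma psiOne_vecMul_meanTensor : psiOne d ᵥ* meanTensor μ C = psiOne d := by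
  funext s
  rw [Matrix.vecMul, psiOne_dotProduct]
  simp only [meanTensor, Matrix.of_apply]
  rw [← integral_finsetSum _ fun τ _ => integrable_kronecker μ hCmeas hCunit (τ, τ) s]
  have h (ω : Ω) : ∑ τ, (C ω ⊗ₖ (C ω).map star) (τ, τ) s = psiOne d s := by
    have := congrFun (congrFun (Matrix.mem_unitaryGroup_iff'.1 (hCunit ω)) s.2) s.1
    rw [Matrix.mul_apply, Matrix.one_apply] at this
    simp only [Matrix.kroneckerMap_apply, Matrix.map_apply, psiOne, eq_comm (a := s.1)]
    rw [← this]
    exact Finset.sum_congr rfl fun τ _ => mul_comm _ _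
  simp only [h, integral_const, probReal_univ, one_smul]

lemma meanM_mulVec_psiOne (v : Fin d → ℝ) : meanM μ C r (-v) v *ᵥ psiOne d = psiOne d := by
  rw [meanM, ← Matrix.mulVec_mulVec, meanTensor_mulVec_psiOne μ hCmeas hCunit, phaseMatrix_eq]
  funext ⟨τ, τ'⟩
  rw [Matrix.mulVec_diagonal]
  by_cases h : τ = τ'
  · subst h
    rw [phase_diag, one_mul]
  · simp [psiOne, h]

lemma psiOne_vecMul_meanM (v : Fin d → ℝ) : psiOne d ᵥ* meanM μ C r (-v) v = psiOne d := by
  rw [meanM, ← Matrix.vecMul_vecMul]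
  have : psiOne d ᵥ* phaseMatrix r (-v) v = psiOne d := by
    rw [phaseMatrix_eq]
    funext ⟨τ, τ'⟩
    rw [Matrix.vecMul_diagonal]
    by_cases h : τ = τ'
    · subst h
      rw [phase_diag, mul_one]
    · simp [psiOne, h]
  rw [this, psiOne_vecMul_meanTensor μ hCmeas hCunit]

lemma reducedResolvent_spec (hd : d ≠ 0) (hS : AssumptionS μ C r) (v : Fin d → ℝ) :
    reducedResolvent μ C r v * (meanM μ C r (-v) v - 1) = 1 - projP d ∧
      reducedResolvent μ C r v *ᵥ psiOne d = 0 ∧ psiOne d ᵥ* reducedResolvent μ C r v = 0 := by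
  have hM := meanM_mulVec_psiOne μ hCmeas hCunit r v
  have hM' := psiOne_vecMul_meanM μ hCmeas hCunit r v
  have hP := projP_mulVec_psiOne hd
  have hPM := projP_mul hM'
  have hMP := mul_projP hM
  have hPP := mul_projP hP
  have hP' : psiOne d ᵥ* projP d = psiOne d := by
    have : (d : ℂ) ≠ 0 := by exact_mod_cast hd
    rw [vecMul_projP, psiOne_dotProduct_self, inv_mul_cancel₀ (by simpa using hd), one_smul]
  have hψ : psiOne d ≠ 0 := by
    intro h
    have h2 := psiOne_dotProduct_self (d := d)
    rw [h, zero_dotProduct] at h2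
    simp_all
  have hdet := isUnit_det_sub_one hM hP hPM hPP hψ (hS v).2
  -- `limUnder` carries information only because the limit is shown to exist.
  have heq : reducedResolvent μ C r v =
      (meanM μ C r (-v) v - projP d - 1)⁻¹ * (1 - projP d) :=
    (tendsto_reduced_resolvent hPM hMP hPP hdet).limUnder_eq
  obtain ⟨h1, h2, h3⟩ := reduced_resolvent_identities hPM hMP hPP hdet
  rw [← heq] at h1 h2 h3
  refine ⟨h1, ?_, ?_⟩
  · rw [← hP, Matrix.mulVec_mulVec, h2, Matrix.zero_mulVec]
  · rw [← hP', Matrix.vecMul_vecMul, h3, Matrix.vecMul_zero]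

end Stationary

/-! ### The quadratic form of the diffusion matrix. -/

section Diffusion

variable {Ω : Type*} [MeasurableSpace Ω] (μ : Measure Ω) [IsProbabilityMeasure μ]
  {C : Ω → Matrix (Coin d) (Coin d) ℂ} (r : Coin d → Fin d → ℤ)

/-- The component along `y` of the jump of the coin state `τ`. -/
def jump (y : Fin d → ℝ) (τ : Coin d) : ℝ := ∑ j, y j * (r τ j : ℝ)

/-- The component along `y` of the drift. -/
def meanJump (y : Fin d → ℝ) : ℝ := ∑ j, y j * drift r j

lemma sum_jump (hd : d ≠ 0) (y : Fin d → ℝ) : ∑ τ, jump r y τ = 2 * d * meanJump r y := by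
  have : (d : ℝ) ≠ 0 := by exact_mod_cast hd
  simp only [jump, meanJump, drift]
  rw [Finset.sum_comm, Finset.mul_sum]
  refine Finset.sum_congr rfl fun j _ => ?_
  rw [← Finset.mul_sum]
  field_simp

omit [IsProbabilityMeasure μ] in
/-- The quadratic form of the diffusion matrix. -/
lemma quadratic_form_diffusionMatrix (v y : Fin d → ℝ) :
    ∑ i, ∑ j, (y i : ℂ) * (y j : ℂ) * diffusionMatrix μ C r v i j =
      (meanJump r y : ℂ) ^ 2 - (2 * (d : ℂ))⁻¹ * ∑ τ, (jump r y τ : ℂ) ^ 2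
        - (2 * (d : ℂ))⁻¹ * (2 * ∑ τ, ∑ τ', (jump r y τ : ℂ) * (jump r y τ' : ℂ)
          * reducedResolvent μ C r v (τ, τ) (τ', τ')) := by
  have hswap2 (f : Fin d → Fin d → Coin d → ℂ) :
      ∑ i, ∑ j, ∑ τ, f i j τ = ∑ τ, ∑ i, ∑ j, f i j τ := by
    simp_rw [Finset.sum_comm (s := (Finset.univ : Finset (Fin d))) (t := (Finset.univ : Finset (Coin d)))]
  have hprod (τ τ' : Coin d) : ∑ i, ∑ j, (y i : ℂ) * y j * ((r τ i : ℂ) * (r τ' j : ℂ)) =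
      (jump r y τ : ℂ) * (jump r y τ' : ℂ) := by
    simp only [jump, Complex.ofReal_sum, Finset.sum_mul_sum]
    refine Finset.sum_congr rfl fun i _ => Finset.sum_congr rfl fun j _ => ?_
    push_cast
    ring
  have hprod' (τ τ' : Coin d) : ∑ i, ∑ j, (y i : ℂ) * y j * ((r τ j : ℂ) * (r τ' i : ℂ)) =
      (jump r y τ : ℂ) * (jump r y τ' : ℂ) := by
    rw [Finset.sum_comm, ← hprod]
    refine Finset.sum_congr rfl fun i _ => Finset.sum_congr rfl fun j _ => ?_
    ring
  simp only [diffusionMatrix, Matrix.of_apply, mul_sub, Finset.sum_sub_distrib]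
  congr 1
  · congr 1
    · simp only [meanJump, sq, Complex.ofReal_sum, Finset.sum_mul_sum]
      refine Finset.sum_congr rfl fun i _ => Finset.sum_congr rfl fun j _ => ?_
      push_cast
      ring
    · simp only [sq, ← hprod, Finset.mul_sum]
      rw [hswap2]
      refine Finset.sum_congr rfl fun τ _ => Finset.sum_congr rfl fun i _ =>
        Finset.sum_congr rfl fun j _ => ?_
      ring
  · have h (τ τ' : Coin d) : 2 * ((jump r y τ : ℂ) * (jump r y τ' : ℂ)
          * reducedResolvent μ C r v (τ, τ) (τ', τ')) =
        ∑ i, ∑ j, (y i : ℂ) * y j * (((r τ i : ℂ) * (r τ' j : ℂ) + (r τ j : ℂ) * (r τ' i : ℂ))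
          * reducedResolvent μ C r v (τ, τ) (τ', τ')) := by
      rw [two_mul]
      nth_rewrite 1 [← hprod]
      rw [← hprod']
      simp only [Finset.sum_mul, ← Finset.sum_add_distrib]
      refine Finset.sum_congr rfl fun i _ => Finset.sum_congr rfl fun j _ => ?_
      ring
    rw [Finset.mul_sum]
    simp only [Finset.mul_sum _ _ (2 : ℂ), h]
    simp only [Finset.mul_sum]
    rw [hswap2]
    refine Finset.sum_congr rfl fun τ _ => ?_
    rw [hswap2]
    refine Finset.sum_congr rfl fun τ' _ => Finset.sum_congr rfl fun i _ =>
      Finset.sum_congr rfl fun j _ => ?_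
    ring

end Diffusion

/-! ### Convergence of characteristic functions. -/

section Convergence

variable {Ω : Type*} [MeasurableSpace Ω] (μ : Measure Ω) [IsProbabilityMeasure μ]
  {C : Ω → Matrix (Coin d) (Coin d) ℂ} (hCmeas : ∀ σ τ, Measurable fun ω => C ω σ τ)
  (hCunit : ∀ ω, C ω ∈ Matrix.unitaryGroup (Coin d) ℂ) (r : Coin d → Fin d → ℤ)

/-- The centred jumps along `y`, as a function on the doubled coin space. -/
def centredJump (y : Fin d → ℝ) (t : Coin d × Coin d) : ℝ := jump r y t.1 - meanJump r y

lemma sum_centredJump (hd : d ≠ 0) (y : Fin d → ℝ) :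
    ∑ τ, (centredJump r y (τ, τ) : ℂ) = 0 := by
  have h : ∑ τ, centredJump r y (τ, τ) = 0 := by
    simp only [centredJump, Finset.sum_sub_distrib, sum_jump r hd]
    simp
    ring
  exact_mod_cast h

lemma sum_sq_centredJump (hd : d ≠ 0) (y : Fin d → ℝ) :
    ∑ τ, (centredJump r y (τ, τ) : ℂ) ^ 2 =
      ∑ τ, (jump r y τ : ℂ) ^ 2 - 2 * d * (meanJump r y : ℂ) ^ 2 := by
  have h : ∑ τ, centredJump r y (τ, τ) ^ 2 =
      ∑ τ, jump r y τ ^ 2 - 2 * d * meanJump r y ^ 2 := by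
    simp only [centredJump, sub_sq, Finset.sum_add_distrib, Finset.sum_sub_distrib, mul_assoc,
      ← Finset.mul_sum]
    simp only [← Finset.sum_mul, sum_jump r hd]
    simp
    ring
  exact_mod_cast h

/-- `S` annihilates `Ψ₁` on both sides, so the centring drops out and the raw jumps of the diffusion
matrix appear. -/
lemma psiOne_jump_dotProduct (S : Matrix (Coin d × Coin d) (Coin d × Coin d) ℂ)
    (hS : S *ᵥ psiOne d = 0) (hS' : psiOne d ᵥ* S = 0) (y : Fin d → ℝ) :
    ((fun t => psiOne d t * centredJump r y t) ᵥ* S) ⬝ᵥ (fun t => psiOne d t * centredJump r y t) =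
      ∑ τ, ∑ τ', (jump r y τ : ℂ) * (jump r y τ' : ℂ) * S (τ, τ) (τ', τ') := by
  have h : (fun t => psiOne d t * centredJump r y t) =
      (fun t => psiOne d t * (jump r y t.1 : ℂ)) - (meanJump r y : ℂ) • psiOne d := by
    funext t
    simp only [centredJump, Pi.sub_apply, Pi.smul_apply, smul_eq_mul]
    push_cast
    ring
  rw [h, Matrix.sub_vecMul, Matrix.smul_vecMul, hS', smul_zero, sub_zero, dotProduct_sub,
    dotProduct_smul, ← Matrix.dotProduct_mulVec _ S (psiOne d), hS, dotProduct_zero, smul_zero,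
    sub_zero, dotProduct_comm, dotProduct]
  simp only [mul_assoc, sum_psiOne_mul, Matrix.vecMul, dotProduct]
  simp only [Finset.mul_sum]
  rw [Finset.sum_comm]
  refine Finset.sum_congr rfl fun τ _ => Finset.sum_congr rfl fun τ' _ => ?_
  ring

omit [IsProbabilityMeasure μ] in
lemma expDiagonal_mul_meanM (v y : Fin d → ℝ) (ε : ℝ) :
    expDiagonal (centredJump r y) ε * meanM μ C r (-v) v =
      Complex.exp (-(Complex.I * ((ε * meanJump r y : ℝ) : ℂ))) • meanM μ C r (ε • y - v) v := by
  rw [meanM, meanM, ← mul_assoc, ← smul_mul_assoc]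
  congr 1
  rw [phaseMatrix_eq, phaseMatrix_eq, expDiagonal, Matrix.diagonal_mul_diagonal,
    ← Matrix.diagonal_smul]
  congr 1
  funext t
  have h : planeWave (ε • y) (r t.1) = Complex.exp (Complex.I * ((ε * jump r y t.1 : ℝ) : ℂ)) := by
    simp only [planeWave, jump, Finset.mul_sum, Pi.smul_apply, smul_eq_mul, mul_assoc]
  rw [Pi.smul_apply, smul_eq_mul, sub_eq_add_neg, planeWave_add_left, h, ← mul_assoc, ← mul_assoc,
    ← mul_assoc, ← Complex.exp_add, centredJump]
  congr 3
  push_cast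
  ring

variable (φ₀ : CoinSpace d)

omit [IsProbabilityMeasure μ] in
lemma expDiagonal_mul_meanM_pow_mulVec (v y : Fin d → ℝ) (ε : ℝ) (n : ℕ)
    (w : Coin d × Coin d → ℂ) :
    (expDiagonal (centredJump r y) ε * meanM μ C r (-v) v) ^ n *ᵥ w =
      Complex.exp (-(Complex.I * ((ε * meanJump r y : ℝ) : ℂ))) ^ n •
        (meanM μ C r (ε • y - v) v ^ n *ᵥ w) := by
  rw [expDiagonal_mul_meanM, smul_pow, Matrix.smul_mulVec]

include hCmeas hCunit

lemma norm_expDiagonal_mul_meanM_pow_le (hφ₀ : ‖φ₀‖ = 1) (v y : Fin d → ℝ) (ε : ℝ) (n : ℕ)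
    (t : Coin d × Coin d) :
    ‖((expDiagonal (centredJump r y) ε * meanM μ C r (-v) v) ^ n *ᵥ
      fun t => φ₀ t.1 * star (φ₀ t.2)) t‖ ≤ 1 := by
  have h : ‖Complex.exp (-(Complex.I * ((ε * meanJump r y : ℝ) : ℂ)))‖ = 1 := by
    simp [Complex.norm_exp]
  rw [expDiagonal_mul_meanM_pow_mulVec, Pi.smul_apply, norm_smul, norm_pow, h, one_pow, one_mul]
  simpa [hφ₀] using norm_meanM_pow_mulVec_le hCmeas r φ₀ hCunit μ n (ε • y - v) v t

/-- The limit of the characteristic function at a fixed point of the torus. -/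
lemma tendsto_fiber (hd : d ≠ 0) (hS : AssumptionS μ C r) {D : Matrix (Fin d) (Fin d) ℝ}
    (hD : D.PosDef) (v : Fin d → ℝ) (hDv : diffusionMatrix μ C r v = D.map Complex.ofReal)
    (hφ₀ : ‖φ₀‖ = 1) (y : Fin d → ℝ) :
    Tendsto (fun n : ℕ => psiOne d ⬝ᵥ
      ((expDiagonal (centredJump r y) (√(n : ℝ))⁻¹ * meanM μ C r (-v) v) ^ n *ᵥ
        fun t => φ₀ t.1 * star (φ₀ t.2))) atTop
      (𝓝 (Complex.exp (-((y ⬝ᵥ D *ᵥ y : ℝ) : ℂ) / 2))) := by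
  have hd' : (d : ℂ) ≠ 0 := by exact_mod_cast hd
  obtain ⟨hS1, hS2, hS3⟩ := reducedResolvent_spec μ hCmeas hCunit r hd hS v
  have hq0 : 0 ≤ y ⬝ᵥ D *ᵥ y := by simpa using hD.posSemidef.dotProduct_mulVec_nonneg y
  have hqf : ((y ⬝ᵥ D *ᵥ y : ℝ) : ℂ) =
      ∑ i, ∑ j, (y i : ℂ) * (y j : ℂ) * diffusionMatrix μ C r v i j := by
    simp only [hDv, Matrix.map_apply, dotProduct, Matrix.mulVec, Finset.mul_sum]
    push_cast
    refine Finset.sum_congr rfl fun i _ => Finset.sum_congr rfl fun j _ => ?_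
    ring
  obtain ⟨ℓ₁, ℓ₂, h1, h2⟩ := exists_perturbation_solution (meanM_mulVec_psiOne μ hCmeas hCunit r v)
    hS1 vecMul_projP (centredJump r y) (y ⬝ᵥ D *ᵥ y)
    (by
      rw [dotProduct]
      simp only [mul_assoc, sum_psiOne_mul, psiOne_diag, mul_one]
      exact sum_centredJump r hd y)
    -- Second-order solvability is the diffusion form times `2d`; the term in `r̄` arises from
    -- centring the squared jumps.
    (by
      rw [psiOne_jump_dotProduct r _ hS2 hS3, hqf, quadratic_form_diffusionMatrix,
        psiOne_dotProduct_self]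
      simp only [mul_assoc, sum_psiOne_mul, psiOne_diag, mul_one]
      rw [sum_sq_centredJump r hd]
      field_simp
      ring)
  have hlim := tendsto_dotProduct_expDiagonal_pow (meanM μ C r (-v) v) (centredJump r y) hq0
    (psiOne d) ℓ₁ ℓ₂ (fun t => φ₀ t.1 * star (φ₀ t.2))
    (psiOne_vecMul_meanM μ hCmeas hCunit r v) h1 h2
    (norm_expDiagonal_mul_meanM_pow_le μ hCmeas hCunit r φ₀ hφ₀ v y)
  have hw : psiOne d ⬝ᵥ (fun t => φ₀ t.1 * star (φ₀ t.2)) = 1 := by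
    have : ((‖φ₀‖ ^ 2 : ℝ) : ℂ) = 1 := by simp [hφ₀]
    rw [psiOne_dotProduct, ← this, EuclideanSpace.norm_sq_eq]
    simp [Complex.mul_conj']
  rwa [hw, mul_one] at hlim

omit hCmeas hCunit in
lemma exp_inner_rescale (n : ℕ) (k : Fin d → ℤ) (y : EuclideanSpace ℝ (Fin d)) :
    Complex.exp ((inner ℝ (rescale r n k) y : ℝ) * Complex.I) =
      Complex.exp (-(Complex.I * (((√(n : ℝ))⁻¹ * meanJump r y : ℝ) : ℂ))) ^ n *
        planeWave ((√(n : ℝ))⁻¹ • y.ofLp) k := by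
  rw [planeWave, ← Complex.exp_nat_mul, ← Complex.exp_add]
  congr 1
  have h : inner ℝ (rescale r n k) y =
      (√(n : ℝ))⁻¹ * (∑ j, y j * (k j : ℝ)) - n * ((√(n : ℝ))⁻¹ * meanJump r y) := by
    simp only [rescale, meanJump, PiLp.inner_apply, Finset.mul_sum, ← Finset.sum_sub_distrib]
    refine Finset.sum_congr rfl fun j _ => ?_
    simp
    ring
  rw [h]
  simp only [Pi.smul_apply, smul_eq_mul, mul_assoc, ← Finset.mul_sum]
  push_cast
  ring

lemma charFun_averagedLaw (n : ℕ) (y : EuclideanSpace ℝ (Fin d)) :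
    charFun ((averagedLaw μ C r φ₀ n).map (rescale r n)) y =
      ∫ v, psiOne d ⬝ᵥ ((expDiagonal (centredJump r y) (√(n : ℝ))⁻¹ * meanM μ C r (-v) v) ^ n *ᵥ
        fun t => φ₀ t.1 * star (φ₀ t.2)) ∂(torusMeasure d) := by
  rw [charFun_apply, integral_map (Measurable.of_discrete).aemeasurable (by fun_prop),
    integral_averagedLaw]
  simp only [exp_inner_rescale, expDiagonal_mul_meanM_pow_mulVec, dotProduct_smul, smul_eq_mul,
    psiOne_dotProduct]
  rw [integral_const_mul, ← sum_planeWave_mul_averagedDist μ hCmeas hCunit, Finset.mul_sum]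
  exact Finset.sum_congr rfl fun k _ => by ring

/-- Pointwise convergence in `v` suffices, as the orbit bound dominates. Constancy of the diffusion
matrix makes the limit a single Gaussian, not a mixture over the torus. -/
lemma tendsto_charFun_averagedLaw (hd : d ≠ 0) (hS : AssumptionS μ C r)
    {D : Matrix (Fin d) (Fin d) ℝ} (hD : D.PosDef)
    (hDv : ∀ v : Fin d → ℝ, diffusionMatrix μ C r v = D.map Complex.ofReal)
    (hφ₀ : ‖φ₀‖ = 1) (y : EuclideanSpace ℝ (Fin d)) :
    Tendsto (fun n => charFun ((averagedLaw μ C r φ₀ n).map (rescale r n)) y) atTop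
      (𝓝 (charFun (multivariateGaussian 0 D) y)) := by
  simp only [charFun_averagedLaw μ hCmeas hCunit]
  have hlim : charFun (multivariateGaussian 0 D) y =
      ∫ _v, Complex.exp (-((y.ofLp ⬝ᵥ D *ᵥ y.ofLp : ℝ) : ℂ) / 2) ∂(torusMeasure d) := by
    rw [charFun_multivariateGaussian hD.posSemidef, integral_const, probReal_univ, one_smul,
      inner_zero_right]
    simp [neg_div]
  rw [hlim]
  refine tendsto_integral_of_dominated_convergence (fun _ => ∑ t, ‖psiOne d t‖) (fun n => ?_)
    (integrable_const _) (fun n => ae_of_all _ fun v => norm_dotProduct_le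
      (norm_expDiagonal_mul_meanM_pow_le μ hCmeas hCunit r φ₀ hφ₀ v _ _ n))
    (ae_of_all _ fun v => tendsto_fiber μ hCmeas hCunit r φ₀ hd hS hD v (hDv v) hφ₀ y)
  refine Continuous.aestronglyMeasurable ?_
  have hM : Continuous fun v : Fin d → ℝ => meanM μ C r (-v) v := by
    have (t : Coin d × Coin d) : Continuous fun v : Fin d → ℝ =>
        planeWave (-v) (r t.1) * planeWave v (r t.2) :=
      ((continuous_planeWave _).comp continuous_neg).mul (continuous_planeWave _)
    simp only [meanM, phaseMatrix_eq]
    exact (Continuous.matrix_diagonal (continuous_pi this)).mul continuous_const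
  exact continuous_const.dotProduct
    (((continuous_const.mul hM).pow n).matrix_mulVec continuous_const)

end Convergence

end QuantumWalk

end

theorem mainTheorem3 {d : ℕ} {Ω : Type*} [MeasurableSpace Ω]
    (μ : Measure Ω) [IsProbabilityMeasure μ]
    (C : Ω → Matrix (QuantumWalk.Coin d) (QuantumWalk.Coin d) ℂ)
    (hCmeas : ∀ σ τ, Measurable fun ω => C ω σ τ)
    (hCunit : ∀ ω, C ω ∈ Matrix.unitaryGroup (QuantumWalk.Coin d) ℂ)
    (r : QuantumWalk.Coin d → Fin d → ℤ)
    (hS : QuantumWalk.AssumptionS μ C r)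
    (D : Matrix (Fin d) (Fin d) ℝ) (hD : D.PosDef)
    (hDv : ∀ v : Fin d → ℝ, QuantumWalk.diffusionMatrix μ C r v = D.map Complex.ofReal)
    (φ₀ : QuantumWalk.CoinSpace d) (hφ₀ : ‖φ₀‖ = 1) :
    ∃ _ : ∀ n, IsProbabilityMeasure (QuantumWalk.averagedLaw μ C r φ₀ n),
      TendstoInDistribution (fun n : ℕ => QuantumWalk.rescale r n) atTop
        (id : EuclideanSpace ℝ (Fin d) → EuclideanSpace ℝ (Fin d))
        (fun n => QuantumWalk.averagedLaw μ C r φ₀ n) (multivariateGaussian 0 D) := by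
  -- For `d = 0` the coin space is trivial and contains no unit vector.
  have hd : d ≠ 0 := by
    rintro rfl
    simp [EuclideanSpace.norm_eq] at hφ₀
  have hprob := QuantumWalk.isProbabilityMeasure_averagedLaw μ hCmeas hCunit r φ₀ hφ₀
  refine ⟨hprob, ⟨fun n => Measurable.of_discrete.aemeasurable, aemeasurable_id, ?_⟩⟩
  refine ProbabilityMeasure.tendsto_iff_tendsto_charFun.2 fun y => ?_
  simpa using QuantumWalk.tendsto_charFun_averagedLaw μ hCmeas hCunit r φ₀ hd hS hD hDv hφ₀ y
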